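/- Let $d\ge 1$ and $j\ge 1$ be integers and let $K\subset\mathbb{R}^d$ be a compact set which meets at least one edge (closed segment joining two nearest neighbours) of the lattice $2^{-j}\mathbb{Z}^d$. Let $E^j:=(2^{-j}\mathbb{Z}^d\cap(\mathbb{R}^d\setminus K))\cup\{a_j^*\}$, where $a_j^*$ is an extra point that replaces all lattice vertices in $K$, with the discrete topology. Let $G^j$ be the graph on $E^j$ in which two vertices $x,y\neq a^*_j$ are adjacent if $|x-y|=2^{-j}$ and the edge between them does not meet $K$, and $x\ne a_j^*$ is adjacent to $a_j^*$ if at least one edge of $2^{-j}\mathbb{Z}^d$ with endpoint $x$ meets $K$. Let $v_j(x)$ be the number of vertices adjacent to $x$ in $G^j$, and let $m_j$ be the measure on $E^j$ with $m_j(x)=\frac{2^{-jd}}{2d}v_j(x)$. Let $\mathcal{E}^j$ be the Dirichlet form on $L^2(E^j,m_j)$ with domain $\mathcal{D}(\mathcal{E}^j)=L^2(E^j,m_j)$ and $$\mathcal{E}^j(f,g)=\frac{2^{-(d-2)j}}{4d}\sum_{(x,y)}(f(x)-f(y))(g(x)-g(y)),$$ where the sum is over all ordered pairs $(x,y)$ of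 adjacent vertices of $G^j$. Let $X^j$ be any right-continuous Markov process on $E^j$ (possibly with a finite lifetime, after which it stays in a cemetery point) associated with $\mathcal{E}^j$; that is, $X^j$ is $m_j$-symmetric, its transition semigroup $(P_t)$ satisfies $\lim_{t\downarrow0}\frac1t(f-P_tf,g)_{L^2(m_j)}=\mathcal{E}^j(f,g)$ for all $f,g\in\mathcal{D}(\mathcal{E}^j)$, and $\mathcal{D}(\mathcal{E}^j)$ is the set of those $f\in L^2(E^j,m_j)$ for which $\frac1t(f-P_tf,f)_{L^2(m_j)}$ has a finite limit as $t\downarrow0$. Then $X^j$ is a pure jump process with constant speed function $\lambda_j=2^{2j}$ and roadmap $$Q_j(x,dy)=\sum_{z\in E^j,\ z\leftrightarrow x\text{ in }G^j}\frac{1}{v_j(x)}\,\delta_{\{z\}}(dy).$$ That is, $Q_j$ is a probability kernel with $Q_j(x,\{x\})=0$, and, from every starting point $x\in E^j$, the process stays at its current position $y$ for an exponentially distributed time with parameter $2^{2j}$ (mean $2^{-2j}$) and then, independently of that time, jumps to a point with law $Q_j(y,\cdot)$, i.e. to each neighbour of $y$ with probability $1/v_j(y)$, and so on, independently of the past given its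 current position. Almost surely it stays in $E^j$ for all times. -/

import Mathlib

open MeasureTheory ProbabilityTheory Filter Topology
open scoped ENNReal NNReal

noncomputable section

namespace Darning

/-! ### Markov processes on a locally compact space with a cemetery -/

/-- The state space with the cemetery `∞` added carries its Borel sets. -/
instance cemeteryMeasurableSpace (V : Type*) [TopologicalSpace V] :
    MeasurableSpace (OnePoint V) := borel _

instance cemeteryBorelSpace (V : Type*) [TopologicalSpace V] : BorelSpace (OnePoint V) := ⟨rfl⟩

/-- A right-continuous (time-homogeneous) Markov process on `V`, with cemetery `∞`, defined on the
sample space `Ω`: `X t` is the position at time `t` and `P x` the law of the process started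
at `x`. The Markov property is with respect to the filtration generated by the process. -/
structure MarkovProcess (V : Type*) [TopologicalSpace V] (Ω : Type*) [MeasurableSpace Ω] where
  X : ℝ≥0 → Ω → OnePoint V
  P : Kernel (OnePoint V) Ω
  isMarkovKernel : IsMarkovKernel P
  measurable_X : ∀ t, Measurable (X t)
  right_continuous : ∀ ω t, ContinuousWithinAt (fun s => X s ω) (Set.Ici t) t
  absorbing : ∀ ω s t, s ≤ t → X s ω = OnePoint.infty → X t ω = OnePoint.infty
  start : ∀ x, ∀ᵐ ω ∂(P x), X 0 ω = x
  markov : ∀ (x : OnePoint V) (s t : ℝ≥0) (A : Set Ω) (B : Set (OnePoint V)),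
    MeasurableSet[⨆ u : Set.Iic s, MeasurableSpace.comap (X u) inferInstance] A →
    MeasurableSet B →
    P x (A ∩ {ω | X (s + t) ω ∈ B}) = ∫⁻ ω in A, P (X s ω) {ω' | X t ω' ∈ B} ∂(P x)

namespace MarkovProcess

variable {V : Type*} [TopologicalSpace V] {Ω : Type*} [MeasurableSpace Ω]

/-- The transition function `P_t(x, ·)` on `V`, a measure of mass at most one: the law of `X t`
under `P x`, restricted to `V` (the process may have been sent to the cemetery). -/
def transition [MeasurableSpace V] (X : MarkovProcess V Ω) (t : ℝ≥0) (x : V) : Measure V :=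
  ((X.P (x : OnePoint V)).map (X.X t)).comap ((↑) : V → OnePoint V)

/-- The approximating form `t⁻¹ (f - P_t f, g)_{L²(m)}`. -/
def approxForm [MeasurableSpace V] (X : MarkovProcess V Ω) (m : Measure V) (t : ℝ≥0)
    (f g : V → ℝ) : ℝ :=
  (t : ℝ)⁻¹ * ∫ x, (f x - ∫ y, f y ∂(X.transition t x)) * g x ∂m

/-- The process `X` is associated with the Dirichlet form `𝓔` with domain `D` on `L²(m)`: `X` is
`m`-symmetric, `D` consists of those `f ∈ L²(m)` for which `t⁻¹ (f - P_t f, f)` has a finite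
limit as `t ↓ 0`, and `𝓔(f, g)` is the limit of `t⁻¹ (f - P_t f, g)` for `f, g ∈ D`. -/
structure IsAssociated [MeasurableSpace V] (X : MarkovProcess V Ω) (m : Measure V)
    (D : Set (V → ℝ)) (𝓔 : (V → ℝ) → (V → ℝ) → ℝ) : Prop where
  symmetric : ∀ (t : ℝ≥0) (f g : V → ℝ≥0∞), Measurable f → Measurable g →
    ∫⁻ x, (∫⁻ y, f y ∂(X.transition t x)) * g x ∂m
      = ∫⁻ x, f x * (∫⁻ y, g y ∂(X.transition t x)) ∂m
  mem_domain_iff : ∀ f : V → ℝ, f ∈ D ↔ MemLp f 2 m ∧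
    ∃ l : ℝ, Tendsto (fun t : ℝ≥0 => X.approxForm m t f f) (𝓝[>] 0) (𝓝 l)
  tendsto_form : ∀ f ∈ D, ∀ g ∈ D,
    Tendsto (fun t : ℝ≥0 => X.approxForm m t f g) (𝓝[>] 0) (𝓝 (𝓔 f g))

/-- `X`, on a countable discrete state space, is a pure jump process with speed function `lam` and
roadmap `Q`. Started at `x`, it visits successively `Y 0 = x, Y 1, Y 2, …`, staying at `Y n` for
a time `S n`. Given `Y n = y` and the past, the holding time `S n` is exponential with parameter
`lam y` and the next position `Y (n + 1)` has law `Q y`, independently of each other. If the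
jump times accumulate, the process is sent to the cemetery at their limit. -/
structure IsPureJump [MeasurableSpace V] [Countable V] [DiscreteTopology V]
    (X : MarkovProcess V Ω) (lam : V → ℝ) (Q : Kernel V V) : Prop where
  speed_pos : ∀ x, 0 < lam x
  isMarkovKernel : IsMarkovKernel Q
  no_loop : ∀ x, Q x {x} = 0
  exists_skeleton : ∀ x : V, ∃ (Y : ℕ → Ω → V) (S : ℕ → Ω → ℝ),
    (∀ n, Measurable (Y n)) ∧ (∀ n, Measurable (S n)) ∧
    (∀ᵐ ω ∂(X.P (x : OnePoint V)), Y 0 ω = x) ∧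
    (∀ (n : ℕ) (y : ℕ → V) (s : ℕ → ℝ), y 0 = x → (∀ i, 0 ≤ s i) →
      X.P (x : OnePoint V) {ω | (∀ i ≤ n, Y i ω = y i) ∧ ∀ i < n, s i < S i ω}
        = ∏ i ∈ Finset.range n,
            ENNReal.ofReal (Real.exp (-lam (y i) * s i)) * Q (y i) {y (i + 1)}) ∧
    (∀ᵐ ω ∂(X.P (x : OnePoint V)),
      (∀ (n : ℕ) (t : ℝ≥0), ∑ i ∈ Finset.range n, S i ω ≤ t →
        t < ∑ i ∈ Finset.range (n + 1), S i ω → X.X t ω = (Y n ω : OnePoint V)) ∧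
      (∀ t : ℝ≥0, (∀ n : ℕ, ∑ i ∈ Finset.range n, S i ω ≤ t) → X.X t ω = OnePoint.infty))

end MarkovProcess

/-! ### The lattice with the vertices in `K` collapsed to one point -/

/-- The set of vertices of the lattice `2^{-j} ℤ^d` in `ℝ^d`. -/
def lattice (d j : ℕ) : Set (EuclideanSpace ℝ (Fin d)) :=
  Set.range fun n : Fin d → ℤ => WithLp.toLp 2 fun i => (n i : ℝ) / 2 ^ j

/-- `x` and `y` are the endpoints of an edge of the lattice `2^{-j} ℤ^d`; the edge itself is the
closed segment `segment ℝ x y`. -/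
def IsLatticeEdge {d : ℕ} (j : ℕ) (x y : EuclideanSpace ℝ (Fin d)) : Prop :=
  x ∈ lattice d j ∧ y ∈ lattice d j ∧ dist x y = 1 / 2 ^ j

variable {d : ℕ}

/-- The state space `E^j`: the lattice vertices outside `K`, and the darning point `none`. -/
def State (K : Set (EuclideanSpace ℝ (Fin d))) (j : ℕ) : Type :=
  Option {x : EuclideanSpace ℝ (Fin d) // x ∈ lattice d j ∧ x ∉ K}

instance (K : Set (EuclideanSpace ℝ (Fin d))) (j : ℕ) : TopologicalSpace (State K j) := ⊥

instance (K : Set (EuclideanSpace ℝ (Fin d))) (j : ℕ) : DiscreteTopology (State K j) := ⟨rfl⟩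

instance (K : Set (EuclideanSpace ℝ (Fin d))) (j : ℕ) : MeasurableSpace (State K j) := ⊤

instance (K : Set (EuclideanSpace ℝ (Fin d))) (j : ℕ) : DiscreteMeasurableSpace (State K j) :=
  ⟨fun _ => trivial⟩

instance (K : Set (EuclideanSpace ℝ (Fin d))) (j : ℕ) : Countable (State K j) := by
  have h : {x | x ∈ lattice d j ∧ x ∉ K}.Countable :=
    (Set.countable_range _).mono fun _ hx => hx.1
  have : Countable {x : EuclideanSpace ℝ (Fin d) // x ∈ lattice d j ∧ x ∉ K} := h.to_subtype
  exact inferInstanceAs (Countable (Option _))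

/-- Adjacency: two lattice vertices outside `K` are adjacent if they are joined by a lattice edge
which does not meet `K`; a lattice vertex outside `K` is adjacent to the darning point if it is
an endpoint of a lattice edge which meets `K`. -/
def Adjacent (K : Set (EuclideanSpace ℝ (Fin d))) (j : ℕ) : State K j → State K j → Prop
  | some x, some y => IsLatticeEdge j x.1 y.1 ∧ segment ℝ x.1 y.1 ∩ K = ∅
  | some x, none => ∃ y, IsLatticeEdge j x.1 y ∧ (segment ℝ x.1 y ∩ K).Nonempty
  | none, some x => ∃ y, IsLatticeEdge j x.1 y ∧ (segment ℝ x.1 y ∩ K).Nonempty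
  | none, none => False

/-- The graph `G^j` on `E^j`. -/
def graph (K : Set (EuclideanSpace ℝ (Fin d))) (j : ℕ) : SimpleGraph (State K j) where
  Adj := Adjacent K j
  symm := ⟨by
    rintro (_ | x) (_ | y) h
    · exact h
    · exact h
    · exact h
    · obtain ⟨⟨hx, hy, hd⟩, hK⟩ := h
      exact ⟨⟨hy, hx, by rw [dist_comm]; exact hd⟩, by rw [segment_symm]; exact hK⟩⟩
  loopless := ⟨by
    rintro (_ | x) h
    · exact h
    · have h0 := h.1.2.2
      rw [dist_self] at h0
      exact absurd h0 (by positivity)⟩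

/-- `v_j(x)`: the number of vertices of `G^j` adjacent to `x`. -/
def valency (K : Set (EuclideanSpace ℝ (Fin d))) (j : ℕ) (x : State K j) : ℕ :=
  ((graph K j).neighborSet x).ncard

/-- The measure `m_j` on `E^j`, with `m_j(x) = 2^{-jd} v_j(x) / (2d)`. -/
def refMeasure (K : Set (EuclideanSpace ℝ (Fin d))) (j : ℕ) : Measure (State K j) :=
  Measure.sum fun x =>
    ENNReal.ofReal ((2 : ℝ) ^ (-((j : ℤ) * d)) / (2 * d) * valency K j x) • Measure.dirac x

/-- The domain of the Dirichlet form: all of `L²(E^j, m_j)`. -/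
def formDomain (K : Set (EuclideanSpace ℝ (Fin d))) (j : ℕ) : Set (State K j → ℝ) :=
  {f | MemLp f 2 (refMeasure K j)}

/-- The Dirichlet form `𝓔^j`, as a bilinear form; `SimpleGraph.Dart` is the type of oriented
edges, so that every edge is counted twice. -/
def form (K : Set (EuclideanSpace ℝ (Fin d))) (j : ℕ) (f g : State K j → ℝ) : ℝ :=
  (2 : ℝ) ^ (-(((d : ℤ) - 2) * j)) / (4 * d) *
    ∑' e : (graph K j).Dart, (f e.fst - f e.snd) * (g e.fst - g e.snd)

/-- The kernel `Q_j(x, dy)`, the sum over the neighbours `z` of `x` of `v_j(x)⁻¹ δ_z(dy)`. -/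
def roadmap (K : Set (EuclideanSpace ℝ (Fin d))) (j : ℕ) : Kernel (State K j) (State K j) where
  toFun x := Measure.sum fun z : (graph K j).neighborSet x =>
    (valency K j x : ℝ≥0∞)⁻¹ • Measure.dirac (z : State K j)
  measurable' := Measurable.of_discrete

end Darning

end

/-! Since singletons have finite mass, their indicators lie in the domain of the form. Testing the
limit of `t⁻¹ (f - P_t f, g)` on indicators of two points and dividing by the mass of one of them
gives the derivative at time `0` of each transition probability: it is that of a jump process with
rate `2 ^ (2 * j)` and jump law `roadmap` (`IsAssociated.hasJumpRates`). The rate does not depend on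
the point, because both `m_j(x)` and the total weight of the edges at `x` are proportional to the
valency.

It remains to recover the law of the paths from these derivatives. The state space is discrete, so
paths are right-locally constant and have well-defined successive positions and holding times.
Observe the process at the multiples of `1 / (k + 1)`. By the Markov property the probability of
following a given itinerary on this grid is an exact product (`measure_visits`): if `p` and `q` are
the one-step probabilities of staying and of making the required jump, each stage contributes `p ^ N
* (1 - p)⁻¹ * q`. As the mesh shrinks, `p ^ N` tends to an exponential and `q / (1 - p)` to the jump
law. Each path determines how fine a grid must be to show its itinerary faithfully, up to an
arbitrarily small slack in the holding times, so the limit is the joint law of positions and holding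
times (`measure_itinerary`).

Since `Q` has mass one, no probability is lost to staying forever or jumping to the cemetery
(`ae_jump`). Since the rate is constant, the holding times are independent with a common exponential
law, and the second Borel–Cantelli lemma makes infinitely many of them exceed `1`: the jump times
tend to infinity (`ae_unbounded`) and the process never dies. -/

namespace Darning

/-! ### Right-locally-constant paths and their jump times -/

section Path

variable {α : Type*}

/-- A path which stays at each of its positions for a positive time. -/
def IsRightLocConst (x : ℝ≥0 → α) : Prop :=
  ∀ t, ∃ ε > 0, ∀ u < ε, x (t + u) = x t

/-- The time which the path `x` still spends at `x t` after time `t` (`0` if it stays forever). -/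
noncomputable def holding (x : ℝ≥0 → α) (t : ℝ≥0) : ℝ≥0 := sInf {u | x (t + u) ≠ x t}

/-- The successive jump times of the path `x`. -/
noncomputable def jumpTime (x : ℝ≥0 → α) : ℕ → ℝ≥0
  | 0 => 0
  | n + 1 => jumpTime x n + holding x (jumpTime x n)

/-- The points of the grid of mesh `1 / (k + 1)`. -/
noncomputable def grid (k i : ℕ) : ℝ≥0 := (i : ℝ≥0) / (k + 1)

/-- The sequence `z` visits successively `y 0, …, y n`, stays at each `y i` with `i < n` for more
than `N i` steps, and reaches `y n` at step `b`. -/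
def Visits (z y : ℕ → α) (N : ℕ → ℕ) : ℕ → ℕ → Prop
  | 0, b => b = 0 ∧ z 0 = y 0
  | n + 1, b => ∃ b' l, b = b' + (N n + 1 + l) ∧ Visits z y N n b' ∧
      (∀ i < N n + 1 + l, z (b' + i) = y n) ∧ z b = y (n + 1)

variable {x : ℝ≥0 → α}

lemma eq_of_lt_holding {t u : ℝ≥0} (hu : u < holding x t) : x (t + u) = x t := by
  by_contra h
  exact notMem_of_lt_csInf' hu h

lemma exists_ne_of_holding_pos {t : ℝ≥0} (h : 0 < holding x t) : ∃ u, x (t + u) ≠ x t := by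
  by_contra! h'
  simp [holding, h'] at h

/-- Right-local constancy at `t` keeps the infimum away from `0`. Applied at `t + holding x t`, it
shows that the infimum is attained: otherwise the path would remain at `x t` a little longer. -/
lemma IsRightLocConst.holding_spec (hx : IsRightLocConst x) {t u : ℝ≥0} (hu : x (t + u) ≠ x t) :
    0 < holding x t ∧ holding x t ≤ u ∧ x (t + holding x t) ≠ x t := by
  have hne : {u | x (t + u) ≠ x t}.Nonempty := ⟨u, hu⟩
  refine ⟨?_, csInf_le' hu, fun h => ?_⟩
  · obtain ⟨ε, hε, h⟩ := hx t
    refine hε.trans_le (le_csInf hne fun v hv => ?_)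
    by_contra! hlt
    exact hv (h v hlt)
  · obtain ⟨ε, hε, h'⟩ := hx (t + holding x t)
    have : holding x t + ε ≤ holding x t := by
      refine le_csInf hne fun v hv => ?_
      by_contra! hlt
      rcases lt_or_ge v (holding x t) with h1 | h1
      · exact hv (eq_of_lt_holding h1)
      · obtain ⟨w, rfl⟩ := exists_add_of_le h1
        apply hv
        rw [← add_assoc, h' w (lt_of_add_lt_add_left hlt), h]
    exact absurd this (not_le.2 (lt_add_of_pos_right _ hε))

lemma IsRightLocConst.ne_of_holding_pos (hx : IsRightLocConst x) {t : ℝ≥0}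
    (h : 0 < holding x t) : x (t + holding x t) ≠ x t := by
  obtain ⟨u, hu⟩ := exists_ne_of_holding_pos h
  exact (hx.holding_spec hu).2.2

lemma grid_lt {k i : ℕ} {t : ℝ≥0} : grid k i < t ↔ i < ⌈t * (k + 1)⌉₊ := by
  rw [Nat.lt_ceil, grid, div_lt_iff₀ (by positivity)]

lemma le_grid {k i : ℕ} {t : ℝ≥0} : t ≤ grid k i ↔ ⌈t * (k + 1)⌉₊ ≤ i := by
  rw [← not_lt, grid_lt, not_lt]

lemma grid_ceil_lt (k : ℕ) (t : ℝ≥0) : grid k ⌈t * (k + 1)⌉₊ < t + 1 / (k + 1) := by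
  rw [grid, div_lt_iff₀ (by positivity), add_mul, one_div_mul_cancel (by positivity)]
  exact Nat.ceil_lt_add_one zero_le

lemma eventually_lt_mul {ε : ℝ≥0} (hε : 0 < ε) (c : ℝ≥0) :
    ∀ᶠ k : ℕ in atTop, c < ε * (k + 1) := by
  obtain ⟨m, hm⟩ := exists_nat_gt (c / ε)
  filter_upwards [eventually_ge_atTop m] with k hk
  rw [div_lt_iff₀' hε] at hm
  refine hm.trans_le (mul_le_mul_right ?_ ε)
  exact (Nat.cast_le.2 hk).trans le_self_add

lemma IsRightLocConst.eventually_grid (hx : IsRightLocConst x) (t : ℝ≥0) :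
    ∀ᶠ k : ℕ in atTop, x (grid k ⌈t * (k + 1)⌉₊) = x t := by
  obtain ⟨ε, hε, h⟩ := hx t
  filter_upwards [eventually_lt_mul hε 1] with k hk
  have h1 : t ≤ grid k ⌈t * (k + 1)⌉₊ := le_grid.2 le_rfl
  obtain ⟨u, hu⟩ := exists_add_of_le h1
  rw [hu]
  refine h u ?_
  have h2 := grid_ceil_lt k t
  rw [hu] at h2
  refine (lt_of_add_lt_add_left h2).trans ?_
  rwa [div_lt_iff₀ (by positivity)]

lemma Visits.eq {z y : ℕ → α} {N : ℕ → ℕ} {n b : ℕ} (h : Visits z y N n b) : z b = y n := by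
  cases n with
  | zero => obtain ⟨rfl, h⟩ := h; exact h
  | succ n => obtain ⟨_, _, _, _, _, h⟩ := h; exact h

lemma eq_of_grid_between {t : ℝ≥0} {k i : ℕ} (h1 : ⌈t * (k + 1)⌉₊ ≤ i)
    (h2 : i < ⌈(t + holding x t) * (k + 1)⌉₊) : x (grid k i) = x t := by
  obtain ⟨u, hu⟩ := exists_add_of_le (le_grid.2 h1)
  have := grid_lt.2 h2
  rw [hu] at this ⊢
  exact eq_of_lt_holding (lt_of_add_lt_add_left this)

/-- `⌈T * (k + 1)⌉₊` indexes the first grid time at or after `T`. On a fine grid this time falls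
before the path moves on, and the strict inequality `s i < holding` absorbs the rounding. -/
lemma IsRightLocConst.eventually_visits (hx : IsRightLocConst x) {y : ℕ → α} {s : ℕ → ℝ≥0} {n : ℕ}
    (hy : ∀ i ≤ n, x (jumpTime x i) = y i) (hs : ∀ i < n, s i < holding x (jumpTime x i)) :
    ∀ᶠ k : ℕ in atTop, Visits (fun i => x (grid k i)) y (fun i => ⌊s i * (k + 1)⌋₊) n
      ⌈jumpTime x n * (k + 1)⌉₊ := by
  induction n with
  | zero =>
    refine Eventually.of_forall fun k => ⟨by simp [jumpTime], ?_⟩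
    simpa [grid, jumpTime] using hy 0 le_rfl
  | succ n ih =>
    have hlt := hs n n.lt_succ_self
    obtain ⟨ε, hε⟩ := exists_add_of_le hlt.le
    have hε0 : 0 < ε := by
      rcases eq_or_lt_of_le (zero_le (a := ε)) with h | h
      · rw [← h, add_zero] at hε; exact absurd hε hlt.ne'
      · exact h
    -- The excess `ε` of the holding time over `s n` must cover two mesh steps: one lost in rounding
    -- up the jump time, one for the strict excess over the floor.
    filter_upwards [ih (fun i hi => hy i (hi.trans n.le_succ)) fun i hi => hs i (hi.trans n.lt_succ_self),
      eventually_lt_mul hε0 2, hx.eventually_grid (jumpTime x (n + 1))] with k h1 h2 h3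
    have hgap : ⌈jumpTime x n * (k + 1)⌉₊ + (⌊s n * (k + 1)⌋₊ + 1)
        ≤ ⌈jumpTime x (n + 1) * (k + 1)⌉₊ := by
      have e1 := Nat.ceil_lt_add_one (zero_le (a := jumpTime x n * (k + 1)))
      have e2 := Nat.floor_le (zero_le (a := s n * (k + 1)))
      have e3 := Nat.le_ceil (jumpTime x (n + 1) * (k + 1))
      rw [jumpTime, hε] at e3
      have : ((⌈jumpTime x n * (k + 1)⌉₊ + (⌊s n * (k + 1)⌋₊ + 1) : ℕ) : ℝ≥0)
        < ⌈jumpTime x (n + 1) * (k + 1)⌉₊ := by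
        rw [jumpTime, hε]
        refine lt_of_lt_of_le ?_ e3
        push_cast
        calc (⌈jumpTime x n * (k + 1)⌉₊ : ℝ≥0) + (⌊s n * (k + 1)⌋₊ + 1)
            < (jumpTime x n * (k + 1) + 1) + (s n * (k + 1) + 1) := add_lt_add_of_lt_of_le e1 (by gcongr)
          _ = jumpTime x n * (k + 1) + s n * (k + 1) + 2 := by ring
          _ ≤ jumpTime x n * (k + 1) + s n * (k + 1) + ε * (k + 1) := by gcongr
          _ = _ := by ring
      exact_mod_cast this.le
    obtain ⟨l, hl⟩ := exists_add_of_le hgap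
    refine ⟨_, l, by rw [hl, add_assoc], h1, fun i hi => ?_, ?_⟩
    · simp only at hi
      rw [← hy n n.le_succ]
      refine eq_of_grid_between (Nat.le_add_right _ _) ?_
      change _ < ⌈jumpTime x (n + 1) * (k + 1)⌉₊
      omega
    · exact h3.trans (hy _ le_rfl)

/-- Partial converse of `eventually_visits`: a grid may overlook a short excursion, but not once it
is fine enough for the path in question to show the state entered at each jump. The slack `s i < s'
i` pays for rounding. -/
lemma IsRightLocConst.eventually_of_visits (hx : IsRightLocConst x) {y : ℕ → α} {s s' : ℕ → ℝ≥0}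
    (hs : ∀ i, s i < s' i) {n : ℕ} (hne : ∀ i < n, y (i + 1) ≠ y i) :
    ∀ᶠ k : ℕ in atTop, ∀ b, Visits (fun i => x (grid k i)) y (fun i => ⌊s' i * (k + 1)⌋₊) n b →
      b = ⌈jumpTime x n * (k + 1)⌉₊ ∧ (∀ i ≤ n, x (jumpTime x i) = y i) ∧
        ∀ i < n, s i < holding x (jumpTime x i) := by
  induction n with
  | zero =>
    refine Eventually.of_forall fun k b hb => ⟨by simpa [jumpTime] using hb.1, fun i hi => ?_, by simp⟩
    obtain rfl : i = 0 := by omega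
    simpa [grid, jumpTime] using hb.2
  | succ n ih =>
    obtain ⟨ε, hε⟩ := exists_add_of_le (hs n).le
    have hε0 : 0 < ε := by
      rcases eq_or_lt_of_le (zero_le (a := ε)) with h | h
      · have := hs n; rw [hε, ← h, add_zero] at this; exact absurd this (lt_irrefl _)
      · exact h
    filter_upwards [ih fun i hi => hne i (hi.trans n.lt_succ_self), eventually_lt_mul hε0 2,
      hx.eventually_grid (jumpTime x (n + 1))] with k h1 h2 h3 b hb
    obtain ⟨b', l, hbb, hv, hc, he⟩ := hb
    obtain ⟨hb', hy, hh⟩ := h1 b' hv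
    have hyn := hy n le_rfl
    have hle : ⌈jumpTime x n * (k + 1)⌉₊ ≤ b := by omega
    obtain ⟨u, hu⟩ := exists_add_of_le (le_grid.2 hle)
    have hne' := hne n n.lt_succ_self
    have hjump : x (jumpTime x n + u) ≠ x (jumpTime x n) := by
      rw [← hu, hyn]; simp only at he; rwa [he]
    obtain ⟨hpos, -, hneq⟩ := hx.holding_spec hjump
    have hmono : ⌈jumpTime x n * (k + 1)⌉₊ ≤ ⌈jumpTime x (n + 1) * (k + 1)⌉₊ := by
      apply Nat.ceil_mono; rw [jumpTime]; gcongr; exact le_self_add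
    -- An earlier `b` would still show `y n`, not `y (n + 1)`; a later one would put the first grid
    -- time after the jump, where the path has left `y n`, inside the run at `y n`.
    have hbeq : b = ⌈jumpTime x (n + 1) * (k + 1)⌉₊ := by
      rcases lt_trichotomy b ⌈jumpTime x (n + 1) * (k + 1)⌉₊ with hlt | heq | hgt
      · have := eq_of_grid_between hle hlt
        simp only at he
        rw [he, hyn] at this
        exact absurd this hne'
      · exact heq
      · obtain ⟨i, hi⟩ := exists_add_of_le hmono
        have h4 := hc i (by omega)
        simp only at h4
        rw [hb', ← hi, h3, ← hyn] at h4
        exact absurd h4 hneq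
    refine ⟨hbeq, fun i hi => ?_, fun i hi => ?_⟩
    · rcases Nat.lt_succ_iff_lt_or_eq.1 (Nat.lt_succ_of_le hi) with h | rfl
      · exact hy i (by omega)
      · rw [← h3, ← hbeq]; exact he
    · rcases Nat.lt_succ_iff_lt_or_eq.1 hi with h | rfl
      · exact hh i h
      · have e1 := Nat.le_ceil (jumpTime x i * (k + 1))
        have e2 := Nat.lt_floor_add_one (s' i * (k + 1))
        have e3 := Nat.ceil_lt_add_one (zero_le (a := jumpTime x (i + 1) * (k + 1)))
        rw [← hbeq, hbb, hb'] at e3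
        push_cast at e3
        have e4 : s' i * (k + 1) < (holding x (jumpTime x i) + ε) * (k + 1) := by
          have e5 : jumpTime x i * (k + 1) + s' i * (k + 1)
              < jumpTime x i * (k + 1) + (holding x (jumpTime x i) + ε) * (k + 1) := by
            calc jumpTime x i * (k + 1) + s' i * (k + 1)
                ≤ ⌈jumpTime x i * (k + 1)⌉₊ + (⌊s' i * (k + 1)⌋₊ + 1 + l) := by
                  refine add_le_add e1 (e2.le.trans ?_)
                  exact le_self_add
              _ < jumpTime x (i + 1) * (k + 1) + 1 := e3
              _ ≤ jumpTime x (i + 1) * (k + 1) + ε * (k + 1) := by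
                gcongr
                exact le_trans (by norm_num) h2.le
              _ = _ := by rw [jumpTime]; ring
          exact lt_of_add_lt_add_left e5
        have e6 := lt_of_mul_lt_mul_right e4 (by positivity)
        rw [hε] at e6
        exact lt_of_add_lt_add_right e6

lemma Visits.congr {z z' y : ℕ → α} {N : ℕ → ℕ} {n b : ℕ} (h : ∀ i ≤ b, z i = z' i) :
    Visits z y N n b ↔ Visits z' y N n b := by
  induction n generalizing b with
  | zero => simp [Visits, h 0 (Nat.zero_le _)]
  | succ n ih =>
    simp only [Visits]
    refine exists_congr fun b' => exists_congr fun l => and_congr_right fun hb => ?_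
    rw [ih fun i hi => h i (by omega), h b le_rfl]
    refine and_congr_right fun _ => and_congr_left fun _ =>
      forall_congr' fun i => imp_congr_right fun hi => ?_
    rw [h _ (by omega)]

/-- The step at which a sequence reaches the end of a given itinerary is unique. -/
lemma Visits.unique {z y : ℕ → α} {N : ℕ → ℕ} {n b c : ℕ} (hne : ∀ i < n, y (i + 1) ≠ y i)
    (hb : Visits z y N n b) (hc : Visits z y N n c) : b = c := by
  induction n generalizing b c with
  | zero => exact hb.1.trans hc.1.symm
  | succ n ih =>
    obtain ⟨b', l, rfl, hb1, hb2, hb3⟩ := hb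
    obtain ⟨c', m, rfl, hc1, hc2, hc3⟩ := hc
    obtain rfl := ih (fun i hi => hne i (hi.trans n.lt_succ_self)) hb1 hc1
    have hn := hne n n.lt_succ_self
    rcases lt_trichotomy l m with h | rfl | h
    · exact absurd (hb3.symm.trans (hc2 _ (by omega))) hn
    · rfl
    · exact absurd (hc3.symm.trans (hb2 _ (by omega))) hn

end Path

/-! ### Two limit lemmas: geometric to exponential, and Fatou for events -/

section Limits

/-- The bounds `1 - p⁻¹ ≤ log p ≤ p - 1` give `(k + 1) * log (p k) → -l`, and the exponent divided
by `k + 1` tends to `s`. -/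
lemma tendsto_pow_floor_exp {p : ℕ → ℝ} {l : ℝ}
    (h : Tendsto (fun k : ℕ => ((k : ℝ) + 1) * (1 - p k)) atTop (𝓝 l)) (s : ℝ≥0) :
    Tendsto (fun k : ℕ => p k ^ ⌊s * ((k : ℝ≥0) + 1)⌋₊) atTop (𝓝 (Real.exp (-l * s))) := by
  have hcast : Tendsto (fun k : ℕ => (k : ℝ) + 1) atTop atTop :=
    tendsto_atTop_add_const_right _ _ tendsto_natCast_atTop_atTop
  have h1 : Tendsto p atTop (𝓝 1) := by
    have h2 := (h.mul (tendsto_inv_atTop_zero.comp hcast)).const_sub 1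
    rw [mul_zero, sub_zero] at h2
    refine h2.congr fun k => ?_
    have : ((k : ℝ) + 1) ≠ 0 := by positivity
    simp only [Function.comp_apply]
    field_simp
    ring
  have hpos : ∀ᶠ k in atTop, 0 < p k := h1.eventually (lt_mem_nhds one_pos)
  have hlog : Tendsto (fun k : ℕ => ((k : ℝ) + 1) * Real.log (p k)) atTop (𝓝 (-l)) := by
    have hlow : Tendsto (fun k : ℕ => -(((k : ℝ) + 1) * (1 - p k)) * (p k)⁻¹) atTop (𝓝 (-l)) := by
      simpa using h.neg.mul (h1.inv₀ one_ne_zero)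
    refine tendsto_of_tendsto_of_tendsto_of_le_of_le' hlow h.neg ?_ ?_
    · filter_upwards [hpos] with k hk
      have := Real.one_sub_inv_le_log_of_pos hk
      calc -(((k : ℝ) + 1) * (1 - p k)) * (p k)⁻¹ = ((k : ℝ) + 1) * (1 - (p k)⁻¹) := by
            field_simp
            ring
        _ ≤ _ := by gcongr
    · filter_upwards [hpos] with k hk
      have := Real.log_le_sub_one_of_pos hk
      calc ((k : ℝ) + 1) * Real.log (p k) ≤ ((k : ℝ) + 1) * (p k - 1) := by gcongr
        _ = -(((k : ℝ) + 1) * (1 - p k)) := by ring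
  have hfloor : Tendsto (fun k : ℕ => (⌊s * ((k : ℝ≥0) + 1)⌋₊ : ℝ) / ((k : ℝ) + 1)) atTop
      (𝓝 (s : ℝ)) := by
    have := (tendsto_nat_floor_mul_div_atTop (R := ℝ) s.coe_nonneg).comp hcast
    refine this.congr fun k => ?_
    simp only [Function.comp_apply]
    congr 2
  have hexp := (Real.continuous_exp.tendsto _).comp (hlog.mul hfloor)
  refine hexp.congr' ?_
  filter_upwards [hpos] with k hk
  have : ((k : ℝ) + 1) ≠ 0 := by positivity
  simp only [Function.comp_apply]
  rw [← Real.exp_log (pow_pos hk _), Real.log_pow]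
  congr 1
  field_simp

/-- Fatou's lemma for sets: `A` lies in the increasing union of the tail intersections of `D`. No
uniformity in `ω` is needed, which lets the required mesh depend on the path. -/
lemma measure_le_of_eventually_mem {Ω : Type*} [MeasurableSpace Ω] {μ : Measure Ω} {A : Set Ω}
    {D : ℕ → Set Ω} {L : ℝ≥0∞} (hAD : ∀ ω ∈ A, ∀ᶠ k in atTop, ω ∈ D k)
    (hL : Tendsto (fun k => μ (D k)) atTop (𝓝 L)) : μ A ≤ L := by
  let E : ℕ → Set Ω := fun m => {ω | ∀ k, m ≤ k → ω ∈ D k}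
  have hE : Monotone E := fun m m' h ω hω k hk => hω k (h.trans hk)
  have hsub : A ⊆ ⋃ m, E m := fun ω hω => by
    obtain ⟨m, hm⟩ := eventually_atTop.1 (hAD ω hω)
    exact Set.mem_iUnion.2 ⟨m, hm⟩
  refine (measure_mono hsub).trans ?_
  rw [hE.measure_iUnion]
  refine iSup_le fun m => ge_of_tendsto hL ?_
  filter_upwards [eventually_ge_atTop m] with k hk
  exact measure_mono fun ω hω => hω k hk

end Limits

/-! ### The process observed on a grid -/

namespace MarkovProcess

variable {V : Type*} [TopologicalSpace V] {Ω : Type*} [MeasurableSpace Ω]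

instance (X : MarkovProcess V Ω) : IsMarkovKernel X.P := X.isMarkovKernel

/-- Points of `V` are open in `OnePoint V`, so right continuity suffices there. The cemetery need
not be isolated, but it is absorbing. -/
lemma isRightLocConst [DiscreteTopology V] (X : MarkovProcess V Ω) (ω : Ω) :
    IsRightLocConst fun t => X.X t ω := by
  intro t
  rcases h : X.X t ω with _ | v
  · exact ⟨1, one_pos, fun u _ => (X.absorbing ω t (t + u) le_self_add h).trans h.symm⟩
  · have ho : IsOpen ({(v : OnePoint V)} : Set (OnePoint V)) := by
      have := OnePoint.isOpenEmbedding_coe.isOpenMap {v} (isOpen_discrete _)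
      rwa [Set.image_singleton] at this
    have h1 := X.right_continuous ω t (ho.mem_nhds h)
    obtain ⟨u, hu, hsub⟩ := (mem_nhdsGE_iff_exists_Ico_subset (a := t)).1 h1
    obtain ⟨ε, rfl⟩ := exists_add_of_le (Set.mem_Ioi.1 hu).le
    refine ⟨ε, ?_, fun w hw => ?_⟩
    · by_contra h0
      obtain rfl : ε = 0 := by simpa using h0
      simp at hu
    · have : X.X (t + w) ω ∈ ({(v : OnePoint V)} : Set (OnePoint V)) :=
        hsub ⟨le_self_add, by gcongr⟩
      exact this.trans h.symm

/-- The events known at time `s`. -/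
abbrev past (X : MarkovProcess V Ω) (s : ℝ≥0) : MeasurableSpace Ω :=
  ⨆ u : Set.Iic s, MeasurableSpace.comap (X.X u) inferInstance

lemma past_le (X : MarkovProcess V Ω) (s : ℝ≥0) : X.past s ≤ ‹MeasurableSpace Ω› :=
  iSup_le fun u => (X.measurable_X u).comap_le

lemma past_mono (X : MarkovProcess V Ω) : Monotone X.past := fun _ t h =>
  iSup_le fun u => le_iSup (fun u : Set.Iic t => MeasurableSpace.comap (X.X u) inferInstance)
    ⟨u, u.2.trans h⟩

variable [DiscreteTopology V]

lemma measurableSet_past (X : MarkovProcess V Ω) {s u : ℝ≥0} (h : u ≤ s) (v : OnePoint V) :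
    MeasurableSet[X.past s] {ω | X.X u ω = v} := by
  refine le_iSup (fun u : Set.Iic s => MeasurableSpace.comap (X.X u) inferInstance) ⟨u, h⟩ _ ?_
  exact ⟨{v}, measurableSet_singleton v, rfl⟩

/-- The integrand in the Markov property is constant when the event fixes the present position. -/
lemma measure_inter_eq (X : MarkovProcess V Ω) (x y v : OnePoint V) {s t : ℝ≥0} {A : Set Ω}
    (hA : MeasurableSet[X.past s] A) (hy : ∀ ω ∈ A, X.X s ω = y) :
    X.P x (A ∩ {ω | X.X (s + t) ω = v}) = X.P x A * X.P y {ω | X.X t ω = v} := by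
  have h := X.markov x s t A {v} hA (measurableSet_singleton v)
  simp only [Set.mem_singleton_iff] at h
  rw [h, setLIntegral_congr_fun (X.past_le s _ hA) (g := fun _ => X.P y {ω | X.X t ω = v})]
  · rw [setLIntegral_const, mul_comm]
  · intro ω hω
    simp only [hy ω hω]

lemma grid_mono {k : ℕ} : Monotone (grid k) := fun i j h => by
  unfold grid; gcongr

lemma grid_add (k i j : ℕ) : grid k (i + j) = grid k i + grid k j := by
  simp [grid, add_div]

lemma measurableSet_visits (X : MarkovProcess V Ω) (k : ℕ) (y : ℕ → OnePoint V) (N : ℕ → ℕ)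
    (n b : ℕ) :
    MeasurableSet[X.past (grid k b)] {ω | Visits (fun i => X.X (grid k i) ω) y N n b} := by
  induction n generalizing b with
  | zero =>
    simp only [Visits]
    exact (MeasurableSet.const _).inter (X.measurableSet_past (grid_mono (Nat.zero_le b)) _)
  | succ n ih =>
    simp only [Visits]
    have hrw : {ω | ∃ b' l, b = b' + (N n + 1 + l) ∧ Visits (fun i => X.X (grid k i) ω) y N n b' ∧
        (∀ i < N n + 1 + l, X.X (grid k (b' + i)) ω = y n) ∧ X.X (grid k b) ω = y (n + 1)}
      = ⋃ b', ⋃ l, ⋃ (_ : b = b' + (N n + 1 + l)),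
        ({ω | Visits (fun i => X.X (grid k i) ω) y N n b'} ∩
          ((⋂ i, ⋂ (_ : i < N n + 1 + l), {ω | X.X (grid k (b' + i)) ω = y n}) ∩
            {ω | X.X (grid k b) ω = y (n + 1)})) := by
      ext ω
      simp only [Set.mem_ofPred_eq, Set.mem_iUnion, Set.mem_inter_iff, Set.mem_iInter, exists_prop]
    rw [hrw]
    refine MeasurableSet.iUnion fun b' => MeasurableSet.iUnion fun l => MeasurableSet.iUnion fun h => ?_
    refine (X.past_mono (grid_mono (by omega)) _ (ih b')).inter (MeasurableSet.inter ?_ ?_)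
    · exact MeasurableSet.iInter fun i => MeasurableSet.iInter fun hi =>
        X.measurableSet_past (grid_mono (by omega)) _
    · exact X.measurableSet_past le_rfl _

lemma measure_run (X : MarkovProcess V Ω) (x y : OnePoint V) (k b m : ℕ) {A : Set Ω}
    (hA : MeasurableSet[X.past (grid k b)] A) (hy : ∀ ω ∈ A, X.X (grid k b) ω = y) :
    X.P x (A ∩ {ω | ∀ i < m + 1, X.X (grid k (b + i)) ω = y})
      = X.P x A * X.P y {ω | X.X (grid k 1) ω = y} ^ m := by
  induction m with
  | zero =>
    rw [pow_zero, mul_one]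
    congr 1
    refine Set.inter_eq_left.2 fun ω hω i hi => ?_
    obtain rfl : i = 0 := by omega
    exact hy ω hω
  | succ m ih =>
    rw [pow_succ, ← mul_assoc, ← ih, ← X.measure_inter_eq x y y (s := grid k (b + m))]
    · congr 1
      ext ω
      simp only [Set.mem_inter_iff, Set.mem_ofPred_eq, and_assoc, and_congr_right_iff,
        ← grid_add, add_assoc]
      exact fun _ => Nat.forall_lt_succ_right
    · refine (X.past_mono (grid_mono (by omega)) _ hA).inter ?_
      have : {ω | ∀ i < m + 1, X.X (grid k (b + i)) ω = y}
          = ⋂ i, ⋂ (_ : i < m + 1), {ω | X.X (grid k (b + i)) ω = y} := by ext ω; simp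
      rw [this]
      exact MeasurableSet.iInter fun i => MeasurableSet.iInter fun hi =>
        X.measurableSet_past (grid_mono (by omega)) _
    · exact fun ω hω => hω.2 m m.lt_succ_self

/-- The probability that the process, observed on a grid, follows a given itinerary. -/
lemma measure_visits (X : MarkovProcess V Ω) (k : ℕ) (y : ℕ → OnePoint V) (N : ℕ → ℕ) (n : ℕ)
    (hne : ∀ i < n, y (i + 1) ≠ y i) :
    X.P (y 0) {ω | ∃ b, Visits (fun i => X.X (grid k i) ω) y N n b}
      = ∏ i ∈ Finset.range n, (X.P (y i) {ω | X.X (grid k 1) ω = y i} ^ N i *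
          ((1 - X.P (y i) {ω | X.X (grid k 1) ω = y i})⁻¹ *
            X.P (y i) {ω | X.X (grid k 1) ω = y (i + 1)})) := by
  have hmeas : ∀ n b, MeasurableSet {ω | Visits (fun i => X.X (grid k i) ω) y N n b} :=
    fun n b => X.past_le _ _ (X.measurableSet_visits k y N n b)
  induction n with
  | zero =>
    have h : ∀ᵐ ω ∂(X.P (y 0)), ω ∈ {ω | ∃ b, Visits (fun i => X.X (grid k i) ω) y N 0 b} := by
      filter_upwards [X.start (y 0)] with ω hω
      exact ⟨0, rfl, by simpa [grid] using hω⟩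
    rw [Finset.prod_range_zero]
    exact (measure_congr (eventuallyEq_univ.2 h)).trans measure_univ
  | succ n ih =>
    have hne' : ∀ i < n, y (i + 1) ≠ y i := fun i hi => hne i (hi.trans n.lt_succ_self)
    let p := X.P (y n) {ω | X.X (grid k 1) ω = y n}
    let q := X.P (y n) {ω | X.X (grid k 1) ω = y (n + 1)}
    -- `F b l`: position `y n` is reached at step `b`, held for `N n + l + 1` observations, hence `N
    -- n + l` transitions from `y n` to itself, and then left for `y (n + 1)`.
    let F : ℕ → ℕ → Set Ω := fun b l =>
      ({ω | Visits (fun i => X.X (grid k i) ω) y N n b} ∩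
        {ω | ∀ i < N n + l + 1, X.X (grid k (b + i)) ω = y n}) ∩
          {ω | X.X (grid k (b + (N n + l)) + grid k 1) ω = y (n + 1)}
    have hF : ∀ b l, X.P (y 0) (F b l)
        = X.P (y 0) {ω | Visits (fun i => X.X (grid k i) ω) y N n b} * p ^ (N n + l) * q := by
      intro b l
      rw [X.measure_inter_eq (y 0) (y n)]
      · rw [X.measure_run (y 0) (y n) k b _ (X.measurableSet_visits k y N n b) fun ω hω => hω.eq]
      · refine (X.past_mono (grid_mono (by omega)) _ (X.measurableSet_visits k y N n b)).inter ?_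
        have : {ω | ∀ i < N n + l + 1, X.X (grid k (b + i)) ω = y n}
            = ⋂ i, ⋂ (_ : i < N n + l + 1), {ω | X.X (grid k (b + i)) ω = y n} := by ext ω; simp
        rw [this]
        exact MeasurableSet.iInter fun i => MeasurableSet.iInter fun hi =>
          X.measurableSet_past (grid_mono (by omega)) _
      · exact fun ω hω => hω.2 _ (Nat.lt_succ_self _)
    have hFm : ∀ b l, MeasurableSet (F b l) := by
      intro b l
      refine ((hmeas n b).inter ?_).inter (X.measurable_X _ (measurableSet_singleton _))
      have : {ω | ∀ i < N n + l + 1, X.X (grid k (b + i)) ω = y n}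
          = ⋂ i, ⋂ (_ : i < N n + l + 1), {ω | X.X (grid k (b + i)) ω = y n} := by ext ω; simp
      rw [this]
      exact MeasurableSet.iInter fun i => MeasurableSet.iInter fun hi =>
        X.measurable_X _ (measurableSet_singleton _)
    have hFv : ∀ b l ω, ω ∈ F b l →
        Visits (fun i => X.X (grid k i) ω) y N (n + 1) (b + (N n + 1 + l)) := by
      rintro b l ω ⟨⟨h1, h2⟩, h3⟩
      refine ⟨b, l, rfl, h1, fun i hi => h2 i (by omega), ?_⟩
      rw [Set.mem_ofPred_eq, ← grid_add] at h3
      have hb : b + (N n + 1 + l) = b + (N n + l) + 1 := by omega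
      rwa [hb]
    have hunion : {ω | ∃ b, Visits (fun i => X.X (grid k i) ω) y N (n + 1) b}
        = ⋃ i : ℕ × ℕ, F i.1 i.2 := by
      ext ω
      simp only [Set.mem_ofPred_eq, Set.mem_iUnion, Prod.exists]
      constructor
      · rintro ⟨b, b', l, rfl, h1, h2, h3⟩
        refine ⟨b', l, ⟨h1, fun i hi => h2 i (by omega)⟩, ?_⟩
        have hb : b' + (N n + l) + 1 = b' + (N n + 1 + l) := by omega
        rwa [Set.mem_ofPred_eq, ← grid_add, hb]
      · rintro ⟨b, l, h⟩
        exact ⟨_, hFv b l ω h⟩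
    have hdisj : Pairwise (Function.onFun Disjoint fun i : ℕ × ℕ => F i.1 i.2) := by
      rintro ⟨b, l⟩ ⟨b', l'⟩ hbl
      refine Set.disjoint_left.2 fun ω h1 h2 => hbl ?_
      have e1 := Visits.unique hne' h1.1.1 h2.1.1
      have e2 := Visits.unique hne (hFv _ _ _ h1) (hFv _ _ _ h2)
      simp only at e1 e2
      ext <;> simp only <;> omega
    have hdisj' : Pairwise (Function.onFun Disjoint fun b =>
        {ω | Visits (fun i => X.X (grid k i) ω) y N n b}) := fun b b' h =>
      Set.disjoint_left.2 fun ω h1 h2 => h (Visits.unique hne' h1 h2)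
    have hn : {ω | ∃ b, Visits (fun i => X.X (grid k i) ω) y N n b}
        = ⋃ b, {ω | Visits (fun i => X.X (grid k i) ω) y N n b} := by ext; simp
    rw [Finset.prod_range_succ, ← ih hne', hunion, measure_iUnion hdisj fun i => hFm _ _, hn,
      measure_iUnion hdisj' (hmeas n), ENNReal.tsum_prod (f := fun b l => X.P (y 0) (F b l)),
      ← ENNReal.tsum_mul_right]
    refine tsum_congr fun b => ?_
    simp_rw [hF, pow_add]
    -- Summing `p ^ l` over the extra steps `l` produces the factor `(1 - p)⁻¹`.
    rw [ENNReal.tsum_mul_right, ENNReal.tsum_mul_left, ENNReal.tsum_mul_left,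
      ENNReal.tsum_geometric]
    ring

end MarkovProcess

lemma IsRightLocConst.exists_grid_ne {α : Type*} {x : ℝ≥0 → α} (hx : IsRightLocConst x)
    {t u s : ℝ≥0} (hu : x (t + u) ≠ x t) (hs : u < s) :
    ∃ k i, grid k i < s ∧ x (t + grid k i) ≠ x t := by
  have hx' : IsRightLocConst fun w => x (t + w) := fun w => by
    obtain ⟨ε, hε, h⟩ := hx (t + w)
    exact ⟨ε, hε, fun v hv => by simpa only [← add_assoc] using h v hv⟩
  obtain ⟨ε, rfl⟩ := exists_add_of_le hs.le
  have hε : 0 < ε := by simpa using hs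
  obtain ⟨k, h1, h2⟩ := ((hx'.eventually_grid u).and (eventually_lt_mul hε 1)).exists
  refine ⟨k, _, (grid_ceil_lt k u).trans_le ?_, by rw [h1]; exact hu⟩
  gcongr
  rw [div_le_iff₀ (by positivity)]
  exact h2.le

/-- Reduces the holding time to countably many observation times, for measurability. The first
alternative is the path that never leaves, whose holding time is `0` by convention. -/
lemma IsRightLocConst.holding_lt_iff {α : Type*} {x : ℝ≥0 → α} (hx : IsRightLocConst x)
    {t s : ℝ≥0} : holding x t < s ↔
      0 < s ∧ ((∀ k i, x (t + grid k i) = x t) ∨ ∃ k i, grid k i < s ∧ x (t + grid k i) ≠ x t) := by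
  constructor
  · intro h
    refine ⟨zero_le.trans_lt h, ?_⟩
    by_cases h0 : 0 < holding x t
    · exact .inr (hx.exists_grid_ne (hx.ne_of_holding_pos h0) h)
    · left
      by_contra! hne
      obtain ⟨k, i, hki⟩ := hne
      exact h0 (hx.holding_spec hki).1
  · rintro ⟨hs, h | ⟨k, i, h1, h2⟩⟩
    · by_contra hn
      have h0 := hs.trans_le (not_lt.1 hn)
      obtain ⟨u, hu⟩ := exists_ne_of_holding_pos h0
      obtain ⟨k, i, -, hki⟩ := hx.exists_grid_ne hu (lt_add_one u)
      exact hki (h k i)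
    · exact (hx.holding_spec h2).2.1.trans_lt h1

/-! ### Successive positions and holding times: measurability and joint law -/

namespace MarkovProcess

variable {V : Type*} [TopologicalSpace V] {Ω : Type*} [MeasurableSpace Ω]

/-- The position after `n` jumps. -/
noncomputable def position (X : MarkovProcess V Ω) (n : ℕ) (ω : Ω) : OnePoint V :=
  X.X (jumpTime (fun t => X.X t ω) n) ω

/-- The time between the `n`-th jump and the next one. -/
noncomputable def holdingTime (X : MarkovProcess V Ω) (n : ℕ) (ω : Ω) : ℝ≥0 :=
  holding (fun t => X.X t ω) (jumpTime (fun t => X.X t ω) n)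

lemma jumpTime_eq_sum (X : MarkovProcess V Ω) (n : ℕ) (ω : Ω) :
    jumpTime (fun t => X.X t ω) n = ∑ i ∈ Finset.range n, X.holdingTime i ω := by
  induction n with
  | zero => rfl
  | succ n ih => rw [Finset.sum_range_succ, ← ih]; rfl

/-- The process visits successively `y 0, …, y n`, and stays at each `y i` with `i < n` for a time
greater than `s i`. -/
noncomputable def itinerary (X : MarkovProcess V Ω) (y : ℕ → V) (s : ℕ → ℝ≥0) (n : ℕ) : Set Ω :=
  {ω | (∀ i ≤ n, X.position i ω = y i) ∧ ∀ i < n, s i < X.holdingTime i ω}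

/-- The transition probabilities of `X` have the derivative at time `0` of a pure jump process with
speed function `lam` and roadmap `Q`. -/
noncomputable def HasJumpRates [MeasurableSpace V] (X : MarkovProcess V Ω) (lam : V → ℝ) (Q : Kernel V V) :
    Prop :=
  ∀ x y : V, Tendsto (fun t : ℝ≥0 => (t : ℝ)⁻¹ *
      (({y} : Set V).indicator 1 x - (X.P (x : OnePoint V)).real {ω | X.X t ω = (y : OnePoint V)}))
    (𝓝[>] 0) (𝓝 (lam x * (({y} : Set V).indicator 1 x - (Q x).real {y})))

lemma tendsto_grid_one : Tendsto (fun k => grid k 1) atTop (𝓝[>] 0) := by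
  refine tendsto_nhdsWithin_iff.2 ⟨?_, Eventually.of_forall fun k => ?_⟩
  · simpa [grid] using tendsto_one_div_add_atTop_nhds_zero_nat (𝕜 := ℝ≥0)
  · simp only [Set.mem_Ioi, grid]; positivity

lemma HasJumpRates.tendsto_grid [MeasurableSpace V] {X : MarkovProcess V Ω} {lam : V → ℝ} {Q : Kernel V V}
    (h : X.HasJumpRates lam Q) (x y : V) :
    Tendsto (fun k : ℕ => ((k : ℝ) + 1) * (({y} : Set V).indicator 1 x -
      (X.P (x : OnePoint V)).real {ω | X.X (grid k 1) ω = (y : OnePoint V)})) atTop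
      (𝓝 (lam x * (({y} : Set V).indicator 1 x - (Q x).real {y}))) := by
  refine ((h x y).comp tendsto_grid_one).congr fun k => ?_
  simp [grid]

variable [DiscreteTopology V]

lemma itinerary_eq_empty (X : MarkovProcess V Ω) {y : ℕ → V} (s : ℕ → ℝ≥0) {n i : ℕ} (hi : i < n)
    (h : y (i + 1) = y i) : X.itinerary y s n = ∅ := by
  refine Set.eq_empty_of_forall_notMem fun ω hω => ?_
  have h1 := (X.isRightLocConst ω).ne_of_holding_pos (zero_le.trans_lt (hω.2 i hi))
  apply h1
  have h2 := hω.1 (i + 1) hi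
  rw [h, ← hω.1 i hi.le] at h2
  exact h2

/-- The limit, as the mesh of the grid tends to `0`, of the probability that the process observed
on the grid follows a given itinerary. -/
lemma HasJumpRates.tendsto_measure_visits [MeasurableSpace V] {X : MarkovProcess V Ω} {lam : V → ℝ} {Q : Kernel V V}
    (h : X.HasJumpRates lam Q) (hlam : ∀ x, 0 < lam x) (hQ : ∀ x, Q x {x} = 0)
    (y : ℕ → V) (s : ℕ → ℝ≥0) (n : ℕ) (hne : ∀ i < n, y (i + 1) ≠ y i) :
    Tendsto (fun k : ℕ => X.P (y 0 : OnePoint V) {ω | ∃ b, Visits (fun i => X.X (grid k i) ω)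
        (fun i => (y i : OnePoint V)) (fun i => ⌊s i * (k + 1)⌋₊) n b}) atTop
      (𝓝 (ENNReal.ofReal (∏ i ∈ Finset.range n,
        (Real.exp (-lam (y i) * s i) * (Q (y i)).real {y (i + 1)})))) := by
  let p : ℕ → ℕ → ℝ := fun i k =>
    (X.P (y i : OnePoint V)).real {ω | X.X (grid k 1) ω = (y i : OnePoint V)}
  let r : ℕ → ℕ → ℝ := fun i k =>
    (X.P (y i : OnePoint V)).real {ω | X.X (grid k 1) ω = (y (i + 1) : OnePoint V)}
  have hp : ∀ i, Tendsto (fun k : ℕ => ((k : ℝ) + 1) * (1 - p i k)) atTop (𝓝 (lam (y i))) := by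
    intro i
    have := h.tendsto_grid (y i) (y i)
    rw [measureReal_def (Q (y i)), hQ] at this
    simpa using this
  have hr : ∀ i < n, Tendsto (fun k : ℕ => ((k : ℝ) + 1) * r i k) atTop
      (𝓝 (lam (y i) * (Q (y i)).real {y (i + 1)})) := by
    intro i hi
    have := (h.tendsto_grid (y i) (y (i + 1))).neg
    rw [Set.indicator_of_notMem (by simpa using (hne i hi).symm)] at this
    simpa using this
  have hlt : ∀ i, ∀ᶠ k in atTop, p i k < 1 := fun i => by
    filter_upwards [(hp i).eventually (lt_mem_nhds (hlam (y i)))] with k hk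
    have := pos_of_mul_pos_right hk (by positivity)
    linarith
  have hlim : ∀ i ∈ Finset.range n, Tendsto
      (fun k : ℕ => p i k ^ ⌊s i * ((k : ℝ≥0) + 1)⌋₊ * ((1 - p i k)⁻¹ * r i k)) atTop
      (𝓝 (Real.exp (-lam (y i) * s i) * (Q (y i)).real {y (i + 1)})) := by
    intro i hi
    refine (tendsto_pow_floor_exp (hp i) (s i)).mul ?_
    -- Both `1 - p` and `r` are of order `1 / (k + 1)`; after rescaling, the speed cancels in their
    -- quotient and only the jump law remains.
    have := ((hp i).inv₀ (hlam (y i)).ne').mul (hr i (Finset.mem_range.1 hi))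
    rw [inv_mul_cancel_left₀ (hlam (y i)).ne'] at this
    refine this.congr fun k => ?_
    have : ((k : ℝ) + 1) ≠ 0 := by positivity
    rw [mul_inv]
    field_simp
  refine (ENNReal.tendsto_ofReal (tendsto_finsetProd _ hlim)).congr' ?_
  have hall : ∀ᶠ k in atTop, ∀ i ∈ Finset.range n, p i k < 1 :=
    (Filter.eventually_all_finset _).2 fun i _ => hlt i
  filter_upwards [hall] with k hk
  rw [X.measure_visits k (fun i => (y i : OnePoint V)) _ n
    (fun i hi => by simpa using hne i hi), ENNReal.ofReal_prod_of_nonneg]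
  · refine Finset.prod_congr rfl fun i hi => ?_
    have h0 : 0 ≤ p i k := measureReal_nonneg
    have h1 : 0 < 1 - p i k := sub_pos.2 (hk i hi)
    rw [ENNReal.ofReal_mul (by positivity), ENNReal.ofReal_pow h0,
      ENNReal.ofReal_mul (by positivity), ENNReal.ofReal_inv_of_pos h1, ENNReal.ofReal_sub _ h0,
      ENNReal.ofReal_one]
    simp only [p, r]
    rw [ofReal_measureReal, ofReal_measureReal]
  · intro i hi
    have h0 : 0 ≤ p i k := measureReal_nonneg
    have h1 : 0 < 1 - p i k := sub_pos.2 (hk i hi)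
    have h2 : 0 ≤ r i k := measureReal_nonneg
    positivity

variable [Countable V]

instance : Countable (OnePoint V) := inferInstanceAs (Countable (Option V))

/-- The first grid time after `T ω` eventually shows the position at `T ω`, so the position is
determined by observations at deterministic times. -/
lemma measurable_X_at (X : MarkovProcess V Ω) {T : Ω → ℝ≥0} (hT : Measurable T) :
    Measurable fun ω => X.X (T ω) ω := by
  refine measurable_to_countable' fun v => ?_
  have hrw : (fun ω => X.X (T ω) ω) ⁻¹' {v}
      = ⋃ m : ℕ, ⋂ k : ℕ, ⋂ _ : m ≤ k, ⋃ i : ℕ,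
        {ω | ⌈T ω * (k + 1)⌉₊ = i} ∩ {ω | X.X (grid k i) ω = v} := by
    ext ω
    simp only [Set.mem_preimage, Set.mem_singleton_iff, Set.mem_iUnion, Set.mem_iInter,
      Set.mem_inter_iff, Set.mem_ofPred_eq, exists_eq_left']
    have h := (X.isRightLocConst ω).eventually_grid (T ω)
    rw [← eventually_atTop]
    constructor
    · intro hv
      filter_upwards [h] with k hk
      rw [hk, hv]
    · intro hv
      obtain ⟨k, h1, h2⟩ := (h.and hv).exists
      exact h1.symm.trans h2
  rw [hrw]
  refine MeasurableSet.iUnion fun m => MeasurableSet.iInter fun k => MeasurableSet.iInter fun _ =>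
    MeasurableSet.iUnion fun i => MeasurableSet.inter ?_ ?_
  · exact (Nat.measurable_ceil.comp (hT.mul_const _)) (measurableSet_singleton i)
  · exact X.measurable_X _ (measurableSet_singleton v)

lemma measurable_holding (X : MarkovProcess V Ω) {T : Ω → ℝ≥0} (hT : Measurable T) :
    Measurable fun ω => holding (fun t => X.X t ω) (T ω) := by
  refine measurable_of_Iio fun s => ?_
  have hset : ∀ k i, MeasurableSet {ω | X.X (T ω + grid k i) ω = X.X (T ω) ω} := fun k i =>
    measurableSet_eq_fun (X.measurable_X_at (hT.add_const _)) (X.measurable_X_at hT)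
  have hrw : (fun ω => holding (fun t => X.X t ω) (T ω)) ⁻¹' Set.Iio s
      = {_ω : Ω | 0 < s} ∩ ((⋂ k, ⋂ i, {ω | X.X (T ω + grid k i) ω = X.X (T ω) ω}) ∪
        ⋃ k, ⋃ i, {_ω : Ω | grid k i < s} ∩ {ω | X.X (T ω + grid k i) ω = X.X (T ω) ω}ᶜ) := by
    ext ω
    simp only [Set.mem_preimage, Set.mem_Iio, (X.isRightLocConst ω).holding_lt_iff,
      Set.mem_inter_iff, Set.mem_union, Set.mem_iInter, Set.mem_iUnion, Set.mem_ofPred_eq,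
      Set.mem_compl_iff, ne_eq]
  rw [hrw]
  exact (MeasurableSet.const _).inter ((MeasurableSet.iInter fun k => MeasurableSet.iInter fun i =>
    hset k i).union (MeasurableSet.iUnion fun k => MeasurableSet.iUnion fun i =>
      (MeasurableSet.const _).inter (hset k i).compl))

lemma measurable_jumpTime (X : MarkovProcess V Ω) (n : ℕ) :
    Measurable fun ω => jumpTime (fun t => X.X t ω) n := by
  induction n with
  | zero => exact measurable_const
  | succ n ih => exact ih.add (X.measurable_holding ih)

lemma measurable_position (X : MarkovProcess V Ω) (n : ℕ) : Measurable (X.position n) :=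
  X.measurable_X_at (X.measurable_jumpTime n)

lemma measurable_holdingTime (X : MarkovProcess V Ω) (n : ℕ) : Measurable (X.holdingTime n) :=
  X.measurable_holding (X.measurable_jumpTime n)

lemma measurableSet_itinerary (X : MarkovProcess V Ω) (y : ℕ → V) (s : ℕ → ℝ≥0) (n : ℕ) :
    MeasurableSet (X.itinerary y s n) := by
  have hrw : X.itinerary y s n = (⋂ i, ⋂ _ : i ≤ n, X.position i ⁻¹' {(y i : OnePoint V)}) ∩
      ⋂ i, ⋂ _ : i < n, X.holdingTime i ⁻¹' Set.Ioi (s i) := by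
    ext ω; simp [itinerary]
  rw [hrw]
  exact (MeasurableSet.iInter fun i => MeasurableSet.iInter fun _ =>
    X.measurable_position i (measurableSet_singleton _)).inter
    (MeasurableSet.iInter fun i => MeasurableSet.iInter fun _ =>
      X.measurable_holdingTime i measurableSet_Ioi)

variable [MeasurableSpace V]

/-- The joint law of the successive positions and holding times. -/
theorem HasJumpRates.measure_itinerary {X : MarkovProcess V Ω} {lam : V → ℝ} {Q : Kernel V V}
    (h : X.HasJumpRates lam Q) (hlam : ∀ x, 0 < lam x) (hQ : ∀ x, Q x {x} = 0)
    (y : ℕ → V) (s : ℕ → ℝ≥0) (n : ℕ) :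
    X.P (y 0 : OnePoint V) (X.itinerary y s n) = ENNReal.ofReal (∏ i ∈ Finset.range n,
        (Real.exp (-lam (y i) * s i) * (Q (y i)).real {y (i + 1)})) := by
  by_cases hne : ∀ i < n, y (i + 1) ≠ y i
  swap
  · push Not at hne
    obtain ⟨i, hi, hyi⟩ := hne
    rw [X.itinerary_eq_empty s hi hyi, measure_empty, Finset.prod_eq_zero (Finset.mem_range.2 hi),
      ENNReal.ofReal_zero]
    simp [hyi, measureReal_def, hQ]
  have hne' : ∀ i < n, (y (i + 1) : OnePoint V) ≠ y i := fun i hi => by simpa using hne i hi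
  apply le_antisymm
  · refine measure_le_of_eventually_mem (fun ω hω => ?_) (h.tendsto_measure_visits hlam hQ y s n hne)
    filter_upwards [(X.isRightLocConst ω).eventually_visits (y := fun i => (y i : OnePoint V))
      hω.1 hω.2] with k hk
    exact ⟨_, hk⟩
  -- For the lower bound, paths outside the itinerary eventually fail the grid test with thresholds
  -- `s i + ε`. Fatou on the complement bounds the probability below by `L ε`, and then `ε → 0`.
  · let L : ℝ≥0 → ℝ≥0∞ := fun ε => ENNReal.ofReal (∏ i ∈ Finset.range n,
        (Real.exp (-lam (y i) * (s i + ε : ℝ≥0)) * (Q (y i)).real {y (i + 1)}))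
    have hcont : Continuous L := by
      refine ENNReal.continuous_ofReal.comp (continuous_finsetProd _ fun i _ => ?_)
      refine Continuous.mul (Real.continuous_exp.comp (continuous_const.mul ?_)) continuous_const
      exact NNReal.continuous_coe.comp (continuous_const.add continuous_id)
    have hL0 : Tendsto L (𝓝[>] 0) (𝓝 (L 0)) := (hcont.tendsto 0).mono_left nhdsWithin_le_nhds
    have hL : ∀ ε : ℝ≥0, 0 < ε → L ε ≤ X.P (y 0 : OnePoint V) (X.itinerary y s n) := by
      intro ε hε
      have hlim := h.tendsto_measure_visits hlam hQ y (fun i => s i + ε) n hne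
      have hmeas : ∀ k : ℕ, MeasurableSet {ω | ∃ b, Visits (fun i => X.X (grid k i) ω)
          (fun i => (y i : OnePoint V)) (fun i => ⌊(s i + ε) * (k + 1)⌋₊) n b} := fun k => by
        rw [Set.ofPred_exists]
        exact MeasurableSet.iUnion fun b => X.past_le _ _ (X.measurableSet_visits k _ _ n b)
      have hlim' := ENNReal.Tendsto.sub (tendsto_const_nhds (x := (1 : ℝ≥0∞))) hlim
        (.inl ENNReal.one_ne_top)
      simp_rw [← prob_compl_eq_one_sub (hmeas _)] at hlim'
      have hle := measure_le_of_eventually_mem (A := (X.itinerary y s n)ᶜ) (fun ω hω => ?_) hlim'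
      · rw [prob_compl_eq_one_sub (X.measurableSet_itinerary y s n)] at hle
        exact (ENNReal.sub_le_sub_iff_left (le_of_tendsto' hlim fun k => prob_le_one)
          ENNReal.one_ne_top).1 hle
      · filter_upwards [(X.isRightLocConst ω).eventually_of_visits
          (y := fun i => (y i : OnePoint V)) (s := s)
          (s' := fun i => s i + ε) (fun i => lt_add_of_pos_right _ hε) hne'] with k hk
        rintro ⟨b, hb⟩
        exact hω (hk b hb).2
    have := le_of_tendsto hL0 (eventually_nhdsWithin_of_forall fun ε hε => hL ε hε)
    simpa [L] using this

end MarkovProcess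

/-! ### Infinitely many jumps and infinite lifetime -/

namespace MarkovProcess

variable {V : Type*} [TopologicalSpace V] {Ω : Type*} [MeasurableSpace Ω]

lemma itinerary_congr (X : MarkovProcess V Ω) {y y' : ℕ → V} {s s' : ℕ → ℝ≥0} {n : ℕ}
    (hy : ∀ i ≤ n, y i = y' i) (hs : ∀ i < n, s i = s' i) :
    X.itinerary y s n = X.itinerary y' s' n := by
  ext ω
  refine and_congr (forall₂_congr fun i hi => by rw [hy i hi])
    (forall₂_congr fun i hi => by rw [hs i hi])

/-- Only `y 0, …, y n` matter, so itineraries can be indexed by the countable type `Fin (n + 1) →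
V`; `Fin.ofNat` reduces modulo `n + 1`, harmlessly for `i ≤ n`. -/
lemma itinerary_word (X : MarkovProcess V Ω) (y : ℕ → V) (s : ℕ → ℝ≥0) (n : ℕ) :
    X.itinerary (fun i => y (Fin.ofNat (n + 1) i : Fin (n + 1))) s n = X.itinerary y s n :=
  X.itinerary_congr (fun i hi => by simp [Nat.mod_eq_of_lt (Nat.lt_succ_of_le hi)]) fun _ _ => rfl

lemma mem_itinerary_succ (X : MarkovProcess V Ω) {y : ℕ → V} {s : ℕ → ℝ≥0} {n : ℕ} {ω : Ω} :
    ω ∈ X.itinerary y s (n + 1) ↔ ω ∈ X.itinerary y s n ∧ s n < X.holdingTime n ω ∧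
      X.position (n + 1) ω = y (n + 1) := by
  constructor
  · rintro ⟨h1, h2⟩
    exact ⟨⟨fun i hi => h1 i (by omega), fun i hi => h2 i (by omega)⟩, h2 n (by omega),
      h1 _ le_rfl⟩
  · rintro ⟨⟨h1, h2⟩, h3, h4⟩
    refine ⟨fun i hi => ?_, fun i hi => ?_⟩
    · rcases Nat.le_succ_iff.1 hi with h | rfl
      exacts [h1 i h, h4]
    · rcases Nat.lt_succ_iff_lt_or_eq.1 hi with h | rfl
      exacts [h2 i h, h3]

variable [DiscreteTopology V] [Countable V]

lemma measurableSet_jump (X : MarkovProcess V Ω) (s : ℝ≥0) (n : ℕ) :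
    MeasurableSet {ω | s < X.holdingTime n ω ∧ ∃ v : V, X.position (n + 1) ω = v} := by
  have hrw : {ω | s < X.holdingTime n ω ∧ ∃ v : V, X.position (n + 1) ω = v}
      = X.holdingTime n ⁻¹' Set.Ioi s ∩
        X.position (n + 1) ⁻¹' Set.range ((↑) : V → OnePoint V) := by
    ext ω
    simp [eq_comm]
  rw [hrw]
  exact (X.measurable_holdingTime n measurableSet_Ioi).inter
    (X.measurable_position _ (Set.to_countable _).measurableSet)

variable [MeasurableSpace V] [DiscreteMeasurableSpace V]
  {X : MarkovProcess V Ω} {lam : V → ℝ} {Q : Kernel V V}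

section Rates

variable [IsMarkovKernel Q]

/-- On an itinerary, the process stays at the last position for a time greater than `s n` and jumps
to a point of `V`, with the probability of the first of these events. -/
lemma HasJumpRates.measure_itinerary_jump (h : X.HasJumpRates lam Q) (hlam : ∀ x, 0 < lam x)
    (hQ : ∀ x, Q x {x} = 0) (x : V) (y : ℕ → V) (s : ℕ → ℝ≥0) (n : ℕ) :
    X.P (x : OnePoint V) (X.itinerary y s n ∩
        {ω | s n < X.holdingTime n ω ∧ ∃ v : V, X.position (n + 1) ω = v})
      = X.P (x : OnePoint V) (X.itinerary y s n) *
        ENNReal.ofReal (Real.exp (-lam (y n) * s n)) := by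
  by_cases hx : y 0 = x
  swap
  · have hnull : X.P (x : OnePoint V) (X.itinerary y s n) = 0 := by
      -- An itinerary that does not begin at `x` lies in the null event `X 0 ≠ x`.
      rw [← nonpos_iff_eq_zero, ← (ae_iff.1 (X.start x))]
      refine measure_mono fun ω hω h0 => hx ?_
      have := (hω.1 0 (Nat.zero_le _)).symm.trans h0
      exact OnePoint.coe_injective this
    rw [hnull, zero_mul]
    exact measure_mono_null Set.inter_subset_left hnull
  subst hx
  let y' : V → ℕ → V := fun v => Function.update y (n + 1) v
  have hy' : ∀ v, ∀ i ≤ n, y' v i = y i := fun v i hi =>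
    Function.update_of_ne (by omega) _ _
  have hunion : X.itinerary y s n ∩
      {ω | s n < X.holdingTime n ω ∧ ∃ v : V, X.position (n + 1) ω = v}
      = ⋃ v, X.itinerary (y' v) s (n + 1) := by
    ext ω
    simp only [Set.mem_inter_iff, Set.mem_ofPred_eq, Set.mem_iUnion, mem_itinerary_succ]
    simp_rw [fun v => X.itinerary_congr (s := s) (s' := s) (hy' v) fun _ _ => rfl]
    simp [y']
  have hdisj : Pairwise (Function.onFun Disjoint fun v => X.itinerary (y' v) s (n + 1)) := by
    intro v w hvw
    refine Set.disjoint_left.2 fun ω h1 h2 => hvw ?_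
    have := (h1.1 _ le_rfl).symm.trans (h2.1 _ le_rfl)
    simpa [y'] using this
  rw [hunion, measure_iUnion hdisj fun v => X.measurableSet_itinerary _ _ _,
    h.measure_itinerary hlam hQ y s n]
  have hterm : ∀ v, X.P (y 0 : OnePoint V) (X.itinerary (y' v) s (n + 1))
      = ENNReal.ofReal (∏ i ∈ Finset.range n,
          (Real.exp (-lam (y i) * s i) * (Q (y i)).real {y (i + 1)})) *
        ENNReal.ofReal (Real.exp (-lam (y n) * s n)) * Q (y n) {v} := by
    intro v
    have h0 := h.measure_itinerary hlam hQ (y' v) s (n + 1)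
    rw [hy' v 0 (Nat.zero_le _)] at h0
    rw [h0, Finset.prod_range_succ, ENNReal.ofReal_mul (by positivity),
      ENNReal.ofReal_mul (by positivity), hy' v n le_rfl, mul_assoc]
    congr 2
    · refine Finset.prod_congr rfl fun i hi => ?_
      rw [Finset.mem_range] at hi
      rw [hy' v i hi.le, hy' v (i + 1) hi]
    · simp [y', ofReal_measureReal]
  simp_rw [hterm]
  have hone : ∑' v, Q (y n) {v} = 1 := by
    rw [← measure_iUnion (fun v w hvw => by simpa using hvw) fun v => measurableSet_singleton v,
      Set.iUnion_of_singleton, measure_univ]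
  rw [ENNReal.tsum_mul_left, hone, mul_one]

/-- Almost surely, the process visits infinitely many points of `V` successively. -/
lemma HasJumpRates.ae_jump (h : X.HasJumpRates lam Q) (hlam : ∀ x, 0 < lam x)
    (hQ : ∀ x, Q x {x} = 0) (x : V) :
    ∀ᵐ ω ∂(X.P (x : OnePoint V)), ∀ n, 0 < X.holdingTime n ω ∧ ∃ v : V, X.position n ω = v := by
  -- With thresholds `0`, `measure_itinerary_jump` says that adding a further jump within `V` does
  -- not change the probability of an itinerary, so the paths without one form a null set.
  have hstep : ∀ (n : ℕ) (w : Fin (n + 1) → V), ∀ᵐ ω ∂(X.P (x : OnePoint V)),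
      ω ∈ X.itinerary (fun i => w (Fin.ofNat (n + 1) i)) 0 n →
        0 < X.holdingTime n ω ∧ ∃ v : V, X.position (n + 1) ω = v := by
    intro n w
    set y : ℕ → V := fun i => w (Fin.ofNat (n + 1) i)
    have heq := h.measure_itinerary_jump hlam hQ x y 0 n
    simp only [Pi.zero_apply, NNReal.coe_zero, mul_zero, Real.exp_zero, ENNReal.ofReal_one,
      mul_one] at heq
    have hmeas : MeasurableSet (X.itinerary y 0 n ∩
        {ω | 0 < X.holdingTime n ω ∧ ∃ v : V, X.position (n + 1) ω = v}) :=
      (X.measurableSet_itinerary _ _ _).inter (X.measurableSet_jump 0 n)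
    have hd := measure_sdiff (μ := X.P (x : OnePoint V)) (Set.inter_subset_left (s := X.itinerary y 0 n)
        (t := {ω | 0 < X.holdingTime n ω ∧ ∃ v : V, X.position (n + 1) ω = v}))
      hmeas.nullMeasurableSet (measure_ne_top _ _)
    rw [heq, tsub_self] at hd
    rw [ae_iff]
    refine measure_mono_null (fun ω hω => ?_) hd
    simp only [Set.mem_ofPred_eq, Classical.not_imp] at hω
    exact ⟨hω.1, fun hc => hω.2 hc.2⟩
  have hall := ae_all_iff.2 fun n => ae_all_iff.2 (hstep n)
  filter_upwards [hall, X.start x] with ω hω h0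
  have key : ∀ n, ∃ y : ℕ → V, ω ∈ X.itinerary y 0 n := by
    intro n
    induction n with
    | zero => exact ⟨fun _ => x, fun i hi => by obtain rfl : i = 0 := by omega
                                                exact h0, fun i hi => absurd hi (by omega)⟩
    | succ n ih =>
      obtain ⟨y, hy⟩ := ih
      obtain ⟨h1, v, h2⟩ := hω n (fun i => y i) (by rwa [X.itinerary_word])
      refine ⟨Function.update y (n + 1) v, X.mem_itinerary_succ.2 ⟨?_, h1, by simpa using h2⟩⟩
      rwa [X.itinerary_congr (y' := y) (fun i hi => Function.update_of_ne (by omega) _ _)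
        fun _ _ => rfl]
  intro n
  obtain ⟨y, hy⟩ := key (n + 1)
  exact ⟨hy.2 n n.lt_succ_self, y n, hy.1 n n.le_succ⟩

/-- With a constant speed function, the holding times are independent exponential variables. -/
lemma HasJumpRates.measure_holdingTime {l : ℝ} (h : X.HasJumpRates (fun _ => l) Q) (hl : 0 < l)
    (hQ : ∀ x, Q x {x} = 0) (x : V) (s : ℕ → ℝ≥0) (n : ℕ) :
    X.P (x : OnePoint V) {ω | ∀ i < n, s i < X.holdingTime i ω}
      = ∏ i ∈ Finset.range n, ENNReal.ofReal (Real.exp (-l * s i)) := by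
  induction n with
  | zero => simp
  | succ n ih =>
    have hae := h.ae_jump (fun _ => hl) hQ x
    let y : (Fin (n + 1) → V) → ℕ → V := fun w i => w (Fin.ofNat (n + 1) i)
    have hdisj : Pairwise (Function.onFun Disjoint fun w => X.itinerary (y w) s n) := by
      intro w w' hw
      refine Set.disjoint_left.2 fun ω h1 h2 => hw (funext fun i => ?_)
      have := (h1.1 i (Nat.lt_succ_iff.1 i.2)).symm.trans (h2.1 i (Nat.lt_succ_iff.1 i.2))
      simpa [y] using this
    have hunion : ∀ (A : Set Ω), MeasurableSet A →
        X.P (x : OnePoint V) ({ω | ∀ i < n, s i < X.holdingTime i ω} ∩ A)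
          = ∑' w, X.P (x : OnePoint V) (X.itinerary (y w) s n ∩ A) := by
      intro A hA
      rw [← measure_iUnion (fun w w' hw => (hdisj hw).mono Set.inter_subset_left
        Set.inter_subset_left) fun w => (X.measurableSet_itinerary _ _ _).inter hA]
      refine measure_congr ?_
      filter_upwards [hae] with ω hω
      apply propext
      choose v hv using fun m => (hω m).2
      change (ω ∈ {ω | ∀ i < n, s i < X.holdingTime i ω} ∩ A) ↔
        (ω ∈ ⋃ w, X.itinerary (y w) s n ∩ A)
      rw [← Set.iUnion_inter]
      refine and_congr_left fun _ => ⟨fun h1 => Set.mem_iUnion.2 ⟨fun i => v i, fun i hi => ?_, h1⟩,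
        fun h1 => ?_⟩
      · simp only [y, Fin.val_ofNat]
        rw [Nat.mod_eq_of_lt (Nat.lt_succ_of_le hi), hv]
      · obtain ⟨w, hw⟩ := Set.mem_iUnion.1 h1
        exact hw.2
    have hsucc : {ω | ∀ i < n + 1, s i < X.holdingTime i ω} =ᵐ[X.P (x : OnePoint V)]
        ({ω | ∀ i < n, s i < X.holdingTime i ω} ∩
          {ω | s n < X.holdingTime n ω ∧ ∃ v : V, X.position (n + 1) ω = v} : Set Ω) := by
      filter_upwards [hae] with ω hω
      apply propext
      change (∀ i < n + 1, _) ↔ ((∀ i < n, _) ∧ _ ∧ _)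
      rw [Nat.forall_lt_succ_right]
      simp [(hω (n + 1)).2]
    rw [measure_congr hsucc, hunion, Finset.prod_range_succ, ← ih]
    -- The exponential factor is the same for every last position because the speed is constant, so
    -- it comes out of the sum over words.
    · simp_rw [h.measure_itinerary_jump (fun _ => hl) hQ x]
      rw [ENNReal.tsum_mul_right]
      congr 1
      simpa using (hunion Set.univ MeasurableSet.univ).symm
    · exact X.measurableSet_jump _ n

/-- With a constant speed function, the jump times do not accumulate. -/
lemma HasJumpRates.ae_unbounded {l : ℝ} (h : X.HasJumpRates (fun _ => l) Q) (hl : 0 < l)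
    (hQ : ∀ x, Q x {x} = 0) (x : V) :
    ∀ᵐ ω ∂(X.P (x : OnePoint V)), ∀ t : ℝ≥0, ∃ n, t < jumpTime (fun t => X.X t ω) n := by
  classical
  let E : ℕ → Set Ω := fun i => {ω | 1 < X.holdingTime i ω}
  have hE : ∀ i, MeasurableSet (E i) := fun i => X.measurable_holdingTime i measurableSet_Ioi
  have hinter : ∀ I : Finset ℕ, X.P (x : OnePoint V) (⋂ i ∈ I, E i)
      = ∏ i ∈ I, ENNReal.ofReal (Real.exp (-l)) := by
    intro I
    obtain ⟨n, hn⟩ := I.exists_nat_subset_range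
    -- Indices outside `I` get threshold `0`: the condition is then almost sure and its factor is
    -- `exp 0 = 1`.
    have h1 := h.measure_holdingTime hl hQ x (fun i => if i ∈ I then 1 else 0) n
    have h2 : {ω | ∀ i < n, (if i ∈ I then 1 else 0) < X.holdingTime i ω}
        =ᵐ[X.P (x : OnePoint V)] (⋂ i ∈ I, E i : Set Ω) := by
      filter_upwards [h.ae_jump (fun _ => hl) hQ x] with ω hω
      apply propext
      change (∀ i < n, _) ↔ ω ∈ ⋂ i ∈ I, E i
      rw [Set.mem_iInter₂]
      refine ⟨fun h3 i hi => ?_, fun h3 i _ => ?_⟩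
      · have := h3 i (Finset.mem_range.1 (hn hi))
        rwa [if_pos hi] at this
      · split_ifs with hi
        exacts [h3 i hi, (hω i).1]
    rw [← measure_congr h2, h1, ← Finset.prod_subset hn]
    · exact Finset.prod_congr rfl fun i hi => by simp [hi]
    · intro i _ hi
      simp [hi]
  have hEi : ∀ i, X.P (x : OnePoint V) (E i) = ENNReal.ofReal (Real.exp (-l)) := fun i => by
    simpa using hinter {i}
  have hind : iIndepSet E (X.P (x : OnePoint V)) := by
    rw [iIndepSet_iff_meas_biInter hE]
    intro I
    rw [hinter I]
    exact Finset.prod_congr rfl fun i _ => (hEi i).symm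
  have hsum : ∑' i, X.P (x : OnePoint V) (E i) = ∞ := by
    simp_rw [hEi]
    exact ENNReal.tsum_const_eq_top_of_ne_zero (by simp [Real.exp_pos])
  have hlim := measure_limsup_eq_one hE hind hsum
  have hlim' : ∀ᵐ ω ∂(X.P (x : OnePoint V)), ω ∈ limsup E atTop := by
    rw [← mem_ae_iff_prob_eq_one (MeasurableSet.measurableSet_limsup hE)] at hlim
    exact hlim
  filter_upwards [hlim'] with ω hω
  rw [mem_limsup_iff_frequently_mem] at hω
  have key : ∀ m : ℕ, ∃ n, (m : ℝ≥0) ≤ jumpTime (fun t => X.X t ω) n := by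
    intro m
    induction m with
    | zero => exact ⟨0, by simp⟩
    | succ m ih =>
      obtain ⟨n, hn⟩ := ih
      obtain ⟨i, hi, hE⟩ := frequently_atTop.1 hω n
      refine ⟨i + 1, ?_⟩
      rw [X.jumpTime_eq_sum] at hn ⊢
      rw [Finset.sum_range_succ]
      push_cast
      refine add_le_add (hn.trans ?_) (le_of_lt hE)
      exact Finset.sum_le_sum_of_subset (by simpa using hi)
  intro t
  obtain ⟨m, hm⟩ := exists_nat_gt t
  obtain ⟨n, hn⟩ := key m
  exact ⟨n, hm.trans_le hn⟩

end Rates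

/-- A process whose transition probabilities have the derivative at time `0` of a pure jump process
with constant speed function is that pure jump process, and has infinite lifetime. -/
theorem HasJumpRates.isPureJump {l : ℝ} (h : X.HasJumpRates (fun _ => l) Q) (hl : 0 < l)
    (hQm : IsMarkovKernel Q) (hQ : ∀ x, Q x {x} = 0) :
    X.IsPureJump (fun _ => l) Q ∧ ∀ x : V, ∀ᵐ ω ∂(X.P (x : OnePoint V)),
      ∀ t, X.X t ω ≠ OnePoint.infty := by
  have hstay : ∀ ω n t, jumpTime (fun t => X.X t ω) n ≤ t →
      t < jumpTime (fun t => X.X t ω) (n + 1) → X.X t ω = X.position n ω := by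
    intro ω n t h1 h2
    obtain ⟨u, rfl⟩ := exists_add_of_le h1
    exact eq_of_lt_holding (x := fun t => X.X t ω) (lt_of_add_lt_add_left h2)
  have hsum : ∀ ω n, ((jumpTime (fun t => X.X t ω) n : ℝ≥0) : ℝ)
      = ∑ i ∈ Finset.range n, (X.holdingTime i ω : ℝ) := fun ω n => by
    rw [X.jumpTime_eq_sum]; push_cast; rfl
  -- The skeleton must take values in `V` everywhere; the cemetery, visited only on a null set, is
  -- replaced by the starting point `x`.
  refine ⟨⟨fun _ => hl, hQm, hQ, fun x => ⟨fun n ω => (X.position n ω).elim x id,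
    fun n ω => X.holdingTime n ω, fun n => ?_, fun n => ?_, ?_, ?_, ?_⟩⟩, fun x => ?_⟩
  · exact (Measurable.of_discrete (f := fun p : OnePoint V => p.elim x id)).comp
      (X.measurable_position n)
  · exact (X.measurable_holdingTime n).coe_nnreal_real
  · filter_upwards [X.start x] with ω hω
    have : X.position 0 ω = x := hω
    simp [this]
  · rintro n y s rfl hs
    have hae : {ω | (∀ i ≤ n, (X.position i ω).elim (y 0) id = y i) ∧
          ∀ i < n, s i < (X.holdingTime i ω : ℝ)}
        =ᵐ[X.P (y 0 : OnePoint V)] X.itinerary y (fun i => (s i).toNNReal) n := by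
      filter_upwards [h.ae_jump (fun _ => hl) hQ (y 0)] with ω hω
      apply propext
      refine and_congr (forall₂_congr fun i hi => ?_) (forall₂_congr fun i hi => ?_)
      · obtain ⟨v, hv⟩ := (hω i).2
        simp [hv]
      · rw [Real.toNNReal_lt_iff_lt_coe (hs i)]
    rw [measure_congr hae, h.measure_itinerary (fun _ => hl) hQ,
      ENNReal.ofReal_prod_of_nonneg fun i _ => by positivity]
    refine Finset.prod_congr rfl fun i _ => ?_
    rw [ENNReal.ofReal_mul (by positivity), ofReal_measureReal, Real.coe_toNNReal _ (hs i)]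
  · filter_upwards [h.ae_jump (fun _ => hl) hQ x, h.ae_unbounded hl hQ x] with ω hω hunb
    refine ⟨fun n t h1 h2 => ?_, fun t ht => ?_⟩
    · rw [← hsum] at h1 h2
      rw [hstay ω n t (mod_cast h1) (mod_cast h2)]
      obtain ⟨v, hv⟩ := (hω n).2
      simp [hv]
    · obtain ⟨n, hn⟩ := hunb t
      have := ht n
      rw [← hsum] at this
      exact absurd hn (not_lt.2 (mod_cast this))
  · filter_upwards [h.ae_jump (fun _ => hl) hQ x, h.ae_unbounded hl hQ x] with ω hω hunb t
    classical
    -- The first jump time beyond `t` identifies the holding interval containing `t`, on which the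
    -- position lies in `V`.
    have hn := Nat.find_spec (hunb t)
    rcases hm : Nat.find (hunb t) with _ | m
    · rw [hm] at hn; exact absurd hn (not_lt.2 zero_le)
    · rw [hm] at hn
      have hle := not_lt.1 (Nat.find_min (hunb t) (m := m) (by omega))
      obtain ⟨v, hv⟩ := (hω m).2
      rw [hstay ω m t hle hn, hv]
      exact OnePoint.coe_ne_infty v

end MarkovProcess

/-! ### Local finiteness of the graph, the roadmap and the form on indicators -/

section Lattice

variable {d : ℕ}

lemma finite_lattice_inter (j : ℕ) (R : ℝ) : {x ∈ lattice d j | ‖x‖ ≤ R}.Finite := by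
  let f : (Fin d → ℤ) → EuclideanSpace ℝ (Fin d) := fun n => WithLp.toLp 2 fun i => (n i : ℝ) / 2 ^ j
  refine ((Set.finite_Icc (fun _ : Fin d => -⌈R * 2 ^ j⌉) (fun _ => ⌈R * 2 ^ j⌉)).image f).subset ?_
  rintro _ ⟨⟨n, rfl⟩, hn⟩
  refine ⟨n, ?_, rfl⟩
  have hb : ∀ i, |(n i : ℝ)| ≤ (⌈R * 2 ^ j⌉ : ℝ) := fun i => by
    have h1 := (PiLp.norm_apply_le (f n) i).trans hn
    have h2 : ‖f n i‖ = |(n i : ℝ)| / 2 ^ j := by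
      simp [f]
    rw [h2, div_le_iff₀ (by positivity)] at h1
    exact h1.trans (Int.le_ceil _)
  have hb' : ∀ i, |n i| ≤ ⌈R * 2 ^ j⌉ := fun i => by exact_mod_cast hb i
  exact ⟨fun i => (abs_le.1 (hb' i)).1, fun i => (abs_le.1 (hb' i)).2⟩

lemma isLatticeEdge_add_single {j : ℕ} {x : EuclideanSpace ℝ (Fin d)} (hx : x ∈ lattice d j)
    (i : Fin d) : IsLatticeEdge j x (x + EuclideanSpace.single i (1 / 2 ^ j)) := by
  refine ⟨hx, ?_, ?_⟩
  · obtain ⟨n, rfl⟩ := hx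
    refine ⟨n + Pi.single i 1, ?_⟩
    ext k
    by_cases hk : k = i
    · subst hk; simp [add_div]
    · simp [hk]
  · rw [dist_self_add_right, PiLp.norm_single, Real.norm_of_nonneg (by positivity)]

variable {K : Set (EuclideanSpace ℝ (Fin d))} {j : ℕ}

lemma finite_setOf_norm_le (R : ℝ) :
    {s : State K j | ∀ x, s = some x → ‖x.1‖ ≤ R}.Finite := by
  have h : {x : {x : EuclideanSpace ℝ (Fin d) // x ∈ lattice d j ∧ x ∉ K} | ‖x.1‖ ≤ R}.Finite := by
    refine ((finite_lattice_inter j R).preimage Subtype.val_injective.injOn).subset fun x hx => ?_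
    exact ⟨x.2.1, hx⟩
  refine ((h.image some).insert none).subset ?_
  rintro (_ | x) hs
  · exact Set.mem_insert _ _
  · exact Set.mem_insert_of_mem _ ⟨x, hs x rfl, rfl⟩

/-- An edge has length at most `1` and `K` is bounded, so even the neighbours of the darning point
lie in a ball, which contains finitely many lattice points. -/
lemma finite_neighborSet (hK : IsCompact K) (s : State K j) :
    ((graph K j).neighborSet s).Finite := by
  have hj : (1 : ℝ) / 2 ^ j ≤ 1 := by
    rw [div_le_one (by positivity)]; exact one_le_pow₀ one_le_two
  obtain ⟨R, hR⟩ := hK.isBounded.exists_norm_le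
  rcases s with _ | x
  · refine (finite_setOf_norm_le (R + 1)).subset ?_
    rintro _ hs y rfl
    obtain ⟨z, ⟨-, -, hz⟩, p, hp, hpK⟩ : Adjacent K j none (some y) := hs
    have h1 := dist_add_dist_of_mem_segment hp
    have h2 := hR p hpK
    have h3 : ‖y.1‖ ≤ ‖p‖ + dist y.1 p := by
      rw [dist_eq_norm]; simpa using norm_add_le p (y.1 - p)
    have := dist_nonneg (x := p) (y := z)
    linarith
  · refine (finite_setOf_norm_le (‖x.1‖ + 1)).subset ?_
    rintro _ hs y rfl
    obtain ⟨⟨-, -, hz⟩, -⟩ : Adjacent K j (some x) (some y) := hs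
    have h3 : ‖y.1‖ ≤ ‖x.1‖ + dist x.1 y.1 := by
      rw [dist_comm, dist_eq_norm]; simpa using norm_add_le x.1 (y.1 - x.1)
    linarith

/-- From a lattice vertex in `K`, walking in a coordinate direction must leave the bounded set `K`;
the first vertex outside is a neighbour of the darning point. For an ordinary vertex, any one
lattice edge gives a neighbour, whether or not it meets `K`. -/
lemma nonempty_neighborSet (hd : 1 ≤ d) (hK : IsCompact K)
    (hKj : ∃ x y, IsLatticeEdge j x y ∧ (segment ℝ x y ∩ K).Nonempty) (s : State K j) :
    ((graph K j).neighborSet s).Nonempty := by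
  let e : EuclideanSpace ℝ (Fin d) := EuclideanSpace.single ⟨0, hd⟩ (1 / 2 ^ j)
  have he : ∀ x ∈ lattice d j, IsLatticeEdge j x (x + e) := fun x hx =>
    isLatticeEdge_add_single hx _
  have hswap : ∀ x y : EuclideanSpace ℝ (Fin d), IsLatticeEdge j x y → IsLatticeEdge j y x :=
    fun x y h => ⟨h.2.1, h.1, by rw [dist_comm]; exact h.2.2⟩
  rcases s with _ | x
  · obtain ⟨x, y, hxy, hne⟩ := hKj
    by_cases hx : x ∈ K
    swap
    · exact ⟨some ⟨x, hxy.1, hx⟩, (⟨y, hxy, hne⟩ : Adjacent K j none (some ⟨x, hxy.1, hx⟩))⟩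
    have hlat : ∀ n : ℕ, x + n • e ∈ lattice d j := fun n => by
      induction n with
      | zero => simpa using hxy.1
      | succ n ih => rw [succ_nsmul, ← add_assoc]; exact (he _ ih).2.1
    have hex : ∃ n : ℕ, x + n • e ∉ K := by
      by_contra! hall
      obtain ⟨R, hR⟩ := hK.isBounded.exists_norm_le
      have hepos : 0 < ‖e‖ := by
        rw [PiLp.norm_single, Real.norm_of_nonneg (by positivity)]
        positivity
      obtain ⟨n, hn⟩ := exists_nat_gt ((R + ‖x‖) / ‖e‖)
      rw [div_lt_iff₀ hepos] at hn
      have h1 := hR _ (hall n)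
      have h2 : ‖n • e‖ ≤ ‖x + n • e‖ + ‖x‖ := by
        simpa using norm_sub_le (x + n • e) x
      rw [RCLike.norm_nsmul ℝ, nsmul_eq_mul] at h2
      linarith
    classical
    have hn := Nat.find_spec hex
    rcases hm : Nat.find hex with _ | m
    · rw [hm] at hn; simp [hx] at hn
    · rw [hm] at hn
      have hmK := not_not.1 (Nat.find_min hex (m := m) (by omega))
      refine ⟨some ⟨_, hlat (m + 1), hn⟩, ?_⟩
      refine (⟨x + m • e, ?_, x + m • e, right_mem_segment ℝ _ _, hmK⟩ :
        Adjacent K j none (some ⟨_, hlat (m + 1), hn⟩))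
      have := hswap _ _ (he _ (hlat m))
      rwa [add_assoc, ← succ_nsmul] at this
  · by_cases h : (segment ℝ x.1 (x.1 + e) ∩ K).Nonempty
    · exact ⟨none, (⟨_, he _ x.2.1, h⟩ : Adjacent K j (some x) none)⟩
    · have hE := he _ x.2.1
      have hy : x.1 + e ∉ K := fun hy => h ⟨_, right_mem_segment ℝ _ _, hy⟩
      exact ⟨some ⟨_, hE.2.1, hy⟩, (⟨hE, Set.not_nonempty_iff_eq_empty.1 h⟩ :
        Adjacent K j (some x) (some ⟨_, hE.2.1, hy⟩))⟩

lemma valency_pos (hd : 1 ≤ d) (hK : IsCompact K)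
    (hKj : ∃ x y, IsLatticeEdge j x y ∧ (segment ℝ x y ∩ K).Nonempty) (s : State K j) :
    0 < valency K j s :=
  (Set.ncard_pos (finite_neighborSet hK s)).2 (nonempty_neighborSet hd hK hKj s)

open Classical in
lemma roadmap_singleton (s z : State K j) :
    roadmap K j s {z} = if (graph K j).Adj s z then (valency K j s : ℝ≥0∞)⁻¹ else 0 := by
  change Measure.sum (fun z : (graph K j).neighborSet s =>
    (valency K j s : ℝ≥0∞)⁻¹ • Measure.dirac (z : State K j)) {z} = _
  rw [Measure.sum_apply _ (measurableSet_singleton z)]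
  split_ifs with h
  · rw [tsum_eq_single ⟨z, h⟩]
    · simp
    · intro w hw
      have : (w : State K j) ≠ z := fun hwz => hw (Subtype.ext hwz)
      simp [this]
  · refine ENNReal.tsum_eq_zero.2 fun w => ?_
    have : (w : State K j) ≠ z := fun hwz => h (hwz ▸ w.2)
    simp [this]

lemma isMarkovKernel_roadmap (hd : 1 ≤ d) (hK : IsCompact K)
    (hKj : ∃ x y, IsLatticeEdge j x y ∧ (segment ℝ x y ∩ K).Nonempty) :
    IsMarkovKernel (roadmap K j) := by
  refine ⟨fun s => ⟨?_⟩⟩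
  change Measure.sum (fun z : (graph K j).neighborSet s =>
    (valency K j s : ℝ≥0∞)⁻¹ • Measure.dirac (z : State K j)) Set.univ = _
  rw [Measure.sum_apply _ MeasurableSet.univ]
  have := (finite_neighborSet hK s).fintype
  simp only [Measure.smul_apply, measure_univ, smul_eq_mul, mul_one, tsum_fintype,
    Finset.sum_const, nsmul_eq_mul, Finset.card_univ]
  rw [← Nat.card_eq_fintype_card]
  exact ENNReal.mul_inv_cancel (by exact_mod_cast (valency_pos hd hK hKj s).ne')
    (ENNReal.natCast_ne_top _)

lemma refMeasure_singleton (s : State K j) :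
    refMeasure K j {s}
      = ENNReal.ofReal ((2 : ℝ) ^ (-((j : ℤ) * d)) / (2 * d) * valency K j s) := by
  rw [refMeasure, Measure.sum_apply _ (measurableSet_singleton s), tsum_eq_single s]
  · simp
  · intro z hz
    simp [hz]

open Classical in
-- Split each summand as `(f a - f b) * g a + (f b - f a) * g b`. Reversing darts exchanges the two
-- terms, whence the factor `2`, and the first is supported on the finitely many darts leaving `x`.
lemma form_indicator (hK : IsCompact K) (x y : State K j) :
    form K j (({y} : Set (State K j)).indicator 1) (({x} : Set (State K j)).indicator 1)
      = (2 : ℝ) ^ (-(((d : ℤ) - 2) * j)) / (4 * d) *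
        (2 * (valency K j x * ({y} : Set (State K j)).indicator 1 x -
          if (graph K j).Adj x y then 1 else 0)) := by
  rw [form]
  congr 1
  set f : State K j → ℝ := ({y} : Set (State K j)).indicator 1
  set g : State K j → ℝ := ({x} : Set (State K j)).indicator 1
  have := (finite_neighborSet hK x).fintype
  have hsum : HasSum (fun e : (graph K j).Dart => (f e.fst - f e.snd) * g e.fst)
      (∑ z : (graph K j).neighborSet x, (f x - f z)) := by
    rw [← Function.Injective.hasSum_iff ((graph K j).dartOfNeighborSet_injective x)]
    · convert hasSum_fintype (fun z : (graph K j).neighborSet x => f x - f z) using 2 with z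
      simp [g, SimpleGraph.dartOfNeighborSet]
    · intro e he
      have : e.fst ≠ x := by
        rintro rfl
        exact he ⟨⟨e.snd, e.adj⟩, rfl⟩
      simp [g, this]
  have hsum' : HasSum (fun e : (graph K j).Dart => (f e.snd - f e.fst) * g e.snd)
      (∑ z : (graph K j).neighborSet x, (f x - f z)) :=
    ((SimpleGraph.Dart.symm_involutive (G := graph K j)).toPerm _).hasSum_iff.2 hsum
  have hval : ∑ z : (graph K j).neighborSet x, (f x - f z)
      = valency K j x * f x - if (graph K j).Adj x y then 1 else 0 := by
    rw [Finset.sum_sub_distrib, Finset.sum_const, Finset.card_univ, nsmul_eq_mul,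
      ← Nat.card_eq_fintype_card]
    congr 1
    split_ifs with h
    · rw [Finset.sum_eq_single ⟨y, h⟩]
      · simp [f]
      · intro w _ hw
        have : (w : State K j) ≠ y := fun hwy => hw (Subtype.ext hwy)
        simp [f, this]
      · simp
    · refine Finset.sum_eq_zero fun w _ => ?_
      have : (w : State K j) ≠ y := fun hwy => h (hwy ▸ w.2)
      simp [f, this]
  rw [← hval, two_mul, ← (hsum.add hsum').tsum_eq]
  refine tsum_congr fun e => ?_
  ring

end Lattice

/-! ### From the Dirichlet form to the jump rates -/

namespace MarkovProcess

variable {V : Type*} [TopologicalSpace V] [DiscreteTopology V] [Countable V] [MeasurableSpace V]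
  [DiscreteMeasurableSpace V] {Ω : Type*} [MeasurableSpace Ω]

lemma transition_singleton (X : MarkovProcess V Ω) (t : ℝ≥0) (x y : V) :
    X.transition t x {y} = X.P (x : OnePoint V) {ω | X.X t ω = (y : OnePoint V)} := by
  rw [transition, Measure.comap_apply _ OnePoint.coe_injective
    (fun s _ => (Set.to_countable _).measurableSet) _ (measurableSet_singleton y),
    Set.image_singleton, Measure.map_apply (X.measurable_X t) (measurableSet_singleton _)]
  rfl

/-- Integrating against the indicator of `x` isolates one transition probability, weighted by the
mass of `x`. -/
lemma approxForm_indicator (X : MarkovProcess V Ω) (m : Measure V) (t : ℝ≥0) (x y : V) :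
    X.approxForm m t (({y} : Set V).indicator 1) (({x} : Set V).indicator 1)
      = m.real {x} * ((t : ℝ)⁻¹ * (({y} : Set V).indicator 1 x -
        (X.P (x : OnePoint V)).real {ω | X.X t ω = (y : OnePoint V)})) := by
  have hint : ∀ z, ∫ w, ({y} : Set V).indicator (1 : V → ℝ) w ∂(X.transition t z)
      = (X.P (z : OnePoint V)).real {ω | X.X t ω = (y : OnePoint V)} := fun z => by
    rw [integral_indicator_one (measurableSet_singleton y), measureReal_def, X.transition_singleton,
      measureReal_def]
  simp only [approxForm, hint]
  have hfun : (fun z => (({y} : Set V).indicator (1 : V → ℝ) z -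
        (X.P (z : OnePoint V)).real {ω | X.X t ω = (y : OnePoint V)}) *
          ({x} : Set V).indicator (1 : V → ℝ) z)
      = ({x} : Set V).indicator fun _ => ({y} : Set V).indicator (1 : V → ℝ) x -
        (X.P (x : OnePoint V)).real {ω | X.X t ω = (y : OnePoint V)} := by
    ext z
    by_cases hz : z = x
    · subst hz; simp
    · simp [hz]
  rw [hfun, integral_indicator_const _ (measurableSet_singleton x), smul_eq_mul]
  ring

lemma IsAssociated.hasJumpRates {d j : ℕ} {K : Set (EuclideanSpace ℝ (Fin d))} (hd : 1 ≤ d)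
    (hK : IsCompact K) (hKj : ∃ x y, IsLatticeEdge j x y ∧ (segment ℝ x y ∩ K).Nonempty)
    {X : MarkovProcess (State K j) Ω}
    (hX : X.IsAssociated (refMeasure K j) (formDomain K j) (form K j)) :
    X.HasJumpRates (fun _ => 2 ^ (2 * j)) (roadmap K j) := by
  classical
  intro x y
  have hmem : ∀ z : State K j, ({z} : Set (State K j)).indicator 1 ∈ formDomain K j := fun z =>
    memLp_indicator_const 2 (measurableSet_singleton z) (1 : ℝ)
      (.inr (by rw [refMeasure_singleton]; exact ENNReal.ofReal_ne_top))
  have hv : (0 : ℝ) < valency K j x := by exact_mod_cast valency_pos hd hK hKj x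
  have hd' : (0 : ℝ) < d := by exact_mod_cast hd
  have hm : (refMeasure K j).real {x} = (2 : ℝ) ^ (-((j : ℤ) * d)) / (2 * d) * valency K j x := by
    rw [measureReal_def, refMeasure_singleton, ENNReal.toReal_ofReal (by positivity)]
  have hm0 : (refMeasure K j).real {x} ≠ 0 := by rw [hm]; positivity
  have h := (hX.tendsto_form _ (hmem y) _ (hmem x)).const_mul ((refMeasure K j).real {x})⁻¹
  simp only [X.approxForm_indicator, inv_mul_cancel_left₀ hm0] at h
  convert h using 2
  rw [form_indicator hK, hm, measureReal_def, roadmap_singleton]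
  -- The speed `2 ^ (2 * j)` is the ratio of the scaling of the form to that of the measure; the
  -- constants `2 / (4 * d)` and `1 / (2 * d)` cancel.
  have hpow : (2 : ℝ) ^ (-(((d : ℤ) - 2) * j)) = 2 ^ (2 * j) * 2 ^ (-((j : ℤ) * d)) := by
    rw [← zpow_natCast, ← zpow_add₀ two_ne_zero]
    congr 1
    push_cast
    ring
  have hQ : (if (graph K j).Adj x y then (valency K j x : ℝ≥0∞)⁻¹ else 0).toReal
      = (if (graph K j).Adj x y then 1 else 0) / (valency K j x : ℝ) := by
    split_ifs <;> simp
  rw [hpow, hQ]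
  have : (2 : ℝ) ^ (-((j : ℤ) * d)) ≠ 0 := by positivity
  field_simp
  ring

end MarkovProcess

end Darning

theorem propositionP {d : ℕ} (hd : 1 ≤ d) (K : Set (EuclideanSpace ℝ (Fin d)))
    (hK : IsCompact K) (j : ℕ) (hj : 1 ≤ j)
    (hKj : ∃ x y, Darning.IsLatticeEdge j x y ∧ (segment ℝ x y ∩ K).Nonempty)
    {Ω : Type*} [MeasurableSpace Ω] (X : Darning.MarkovProcess (Darning.State K j) Ω)
    (hX : X.IsAssociated (Darning.refMeasure K j) (Darning.formDomain K j) (Darning.form K j)) :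
    X.IsPureJump (fun _ => 2 ^ (2 * j)) (Darning.roadmap K j) ∧
      ∀ x : Darning.State K j, ∀ᵐ ω ∂(X.P (x : OnePoint (Darning.State K j))),
        ∀ t, X.X t ω ≠ OnePoint.infty := by
  refine (hX.hasJumpRates hd hK hKj).isPureJump (by positivity)
    (Darning.isMarkovKernel_roadmap hd hK hKj) fun x => ?_
  rw [Darning.roadmap_singleton, if_neg ((Darning.graph K j).loopless.irrefl x)]
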